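/- Let $G$ be a finite group. Let $\mathbb{Z}[G]\text{-Chain}$ be the category of (unbounded, $\mathbb{Z}$-graded) chain complexes of $\mathbb{Z}[G]$-modules. A chain map $f:C\to D$ is an *fp-equivalence* if for every subgroup $H\subseteq G$ the induced map $f^H:C^H\to D^H$ on $H$-fixed points is a quasi-isomorphism. Let $D_{fp}(G)$ be the localization of $\mathbb{Z}[G]\text{-Chain}$ at the fp-equivalences. Let $\mathscr{B}_G$ be the Burnside category: its objects are the finite $G$-sets, and its morphisms from $S$ to $T$ form the group completion of the monoid, under disjoint union in $A$, of isomorphism classes of diagrams $S\leftarrow A\to T$ of finite $G$-sets, composed by pullback. A Mackey functor is an additive functor $\mathscr{B}_G\to \mathrm{Ab}$. The box product $M\,\Box\, N$ is the left Kan extension of $(S,T)\mapsto M(S)\otimes N(T)$ along the cartesian product $\mathscr{B}_G\times\mathscr{B}_G\to\mathscr{B}_G$; a Green functor is a commutative monoid for $\Box$, and a Mackey module over a Green functor $R$ is a Mackey functor $M$ with an associative unital action $M\,\Box\, R\to M$. For a $\mathbb{Z}[G]$-module $V$ let $\underline{V}$ be its fixed point Mackey functor $S\mapsto \mathrm{Map}_G(S,V)$,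 so $G/H\mapsto V^H$, where restrictions are precomposition and transfers are sums over fibres. The constant Green functor $\underline{\mathbb{Z}}$ is the fixed point functor of the trivial module $\mathbb{Z}$, with multiplication of integers; each $\underline{V}$ is a $\underline{\mathbb{Z}}$-module. Let $D(\underline{\mathbb{Z}}\text{-Mod})$ be the (unbounded) derived category of the abelian category $\underline{\mathbb{Z}}\text{-Mod}$ of Mackey modules over $\underline{\mathbb{Z}}$. Then $D_{fp}(G)$ is equivalent to $D(\underline{\mathbb{Z}}\text{-Mod})$. More precisely, there is an equivalence of categories $D_{fp}(G)\simeq D(\underline{\mathbb{Z}}\text{-Mod})$ whose composite with the localization functor $\mathbb{Z}[G]\text{-Chain}\to D_{fp}(G)$ is isomorphic to the functor $C\mapsto\underline{C}$, $\underline{C}(G/H)=C^H$. -/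

import Mathlib

open CategoryTheory

universe w u v

namespace MackeyChains

noncomputable section

/-- The objects of the Burnside category of `G`: finite `G`-sets. -/
structure Burnside (G : Type u) [Group G] : Type (u + 1) where
  carrier : Type u
  [action : MulAction G carrier]
  [finite : Finite carrier]

namespace Burnside

attribute [instance] action finite

variable {G : Type u} [Group G]

instance : CoeSort (Burnside G) (Type u) := ⟨carrier⟩

/-- The cartesian product of finite `G`-sets, with diagonal action. -/
def prod (S T : Burnside G) : Burnside G := ⟨S × T⟩

/-- The one-point `G`-set `G/G`. -/
def point (G : Type u) [Group G] : Burnside G :=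
  letI : MulAction G PUnit.{u + 1} :=
    { smul := fun _ x => x, one_smul := fun _ => rfl, mul_smul := fun _ _ _ => rfl }
  ⟨PUnit⟩

/-- A diagram `S ← A → T` of finite `G`-sets. -/
structure Span (S T : Burnside G) : Type (u + 1) where
  apex : Burnside G
  left : apex →[G] S
  right : apex →[G] T

namespace Span

variable {S T U S' T' U' : Burnside G}

/-- Two diagrams are isomorphic if there is an isomorphism of apices over `S` and `T`. -/
def IsIso (A B : Span S T) : Prop :=
  ∃ e : A.apex ≃ B.apex, (∀ (g : G) x, e (g • x) = g • e x) ∧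
    (∀ x, B.left (e x) = A.left x) ∧ ∀ x, B.right (e x) = A.right x

instance setoid (S T : Burnside G) : Setoid (Span S T) where
  r := IsIso
  iseqv :=
    { refl := fun A => ⟨Equiv.refl _, fun _ _ => rfl, fun _ => rfl, fun _ => rfl⟩
      symm := by
        rintro A B ⟨e, h1, h2, h3⟩
        refine ⟨e.symm, fun g x => ?_, fun x => ?_, fun x => ?_⟩
        · rw [Equiv.symm_apply_eq, h1, Equiv.apply_symm_apply]
        · rw [← h2, Equiv.apply_symm_apply]
        · rw [← h3, Equiv.apply_symm_apply]
      trans := by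
        rintro A B C ⟨e, h1, h2, h3⟩ ⟨e', h1', h2', h3'⟩
        exact ⟨e.trans e', fun g x => by simp [h1, h1'], fun x => by simp [h2, h2'],
          fun x => by simp [h3, h3']⟩ }

/-- The graph `S = S → T` of an equivariant map. -/
def graph (f : S →[G] T) : Span S T := ⟨S, MulActionHom.id G, f⟩

/-- The empty diagram. -/
def empty (S T : Burnside G) : Span S T :=
  letI : MulAction G PEmpty.{u + 1} :=
    { smul := fun _ x => x, one_smul := fun _ => rfl, mul_smul := fun _ _ _ => rfl }
  ⟨⟨PEmpty⟩, ⟨fun x => x.elim, fun _ x => x.elim⟩, ⟨fun x => x.elim, fun _ x => x.elim⟩⟩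

/-- The coproduct of two diagrams, in the apex. -/
def sum (A B : Span S T) : Span S T where
  apex := ⟨A.apex ⊕ B.apex⟩
  left := ⟨Sum.elim A.left B.left, by rintro g (x | x) <;> simp⟩
  right := ⟨Sum.elim A.right B.right, by rintro g (x | x) <;> simp⟩

/-- The fibre product of `A → T ← B`. -/
def fibre (A : Span S T) (B : Span T U) : Burnside G :=
  letI : MulAction G {p : A.apex × B.apex // A.right p.1 = B.left p.2} :=
    { smul := fun g p => ⟨g • p.1, by simp [p.2]⟩
      one_smul := fun p => Subtype.ext (one_smul G p.1)
      mul_smul := fun g h p => Subtype.ext (mul_smul g h p.1) }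
  ⟨{p : A.apex × B.apex // A.right p.1 = B.left p.2}⟩

/-- Composition of diagrams by pullback. -/
def comp (A : Span S T) (B : Span T U) : Span S U where
  apex := fibre A B
  left := ⟨fun p => A.left p.1.1, fun g p => map_smul A.left g p.1.1⟩
  right := ⟨fun p => B.right p.1.2, fun g p => map_smul B.right g p.1.2⟩

/-- The cartesian product of two diagrams. -/
def prod (A : Span S T) (B : Span S' T') : Span (S.prod S') (T.prod T') where
  apex := A.apex.prod B.apex
  left := ⟨fun p => (A.left p.1, B.left p.2),
    fun g p => Prod.ext (map_smul A.left g p.1) (map_smul B.left g p.2)⟩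
  right := ⟨fun p => (A.right p.1, B.right p.2),
    fun g p => Prod.ext (map_smul A.right g p.1) (map_smul B.right g p.2)⟩

end Span

/-- Isomorphism classes of diagrams `S ← A → T`. -/
def SpanClass (S T : Burnside G) : Type (u + 1) := Quotient (Span.setoid S T)

namespace SpanClass

variable {S T U V S' T' U' : Burnside G}

/-- The class of a diagram. -/
def mk (A : Span S T) : SpanClass S T := Quotient.mk _ A

theorem ind {P : SpanClass S T → Prop} (h : ∀ A, P (mk A)) (x : SpanClass S T) : P x :=
  Quotient.inductionOn x h

theorem sound {A B : Span S T} (e : A.apex ≃ B.apex) (h : ∀ (g : G) x, e (g • x) = g • e x)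
    (hl : ∀ x, B.left (e x) = A.left x) (hr : ∀ x, B.right (e x) = A.right x) :
    mk A = mk B :=
  Quotient.sound ⟨e, h, hl, hr⟩

instance : Zero (SpanClass S T) := ⟨mk (Span.empty S T)⟩

instance : Add (SpanClass S T) :=
  ⟨Quotient.map₂ Span.sum (by
    rintro A A' ⟨e, h1, h2, h3⟩ B B' ⟨f, k1, k2, k3⟩
    refine ⟨Equiv.sumCongr e f, ?_, ?_, ?_⟩
    · rintro g (x | x)
      · exact congrArg Sum.inl (h1 g x)
      · exact congrArg Sum.inr (k1 g x)
    · rintro (x | x)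
      · exact h2 x
      · exact k2 x
    · rintro (x | x)
      · exact h3 x
      · exact k3 x)⟩

theorem mk_add (A B : Span S T) : mk A + mk B = mk (A.sum B) := rfl

theorem zero_def : (0 : SpanClass S T) = mk (Span.empty S T) := rfl

/-- The commutative monoid structure given by coproducts. -/
instance : AddCommMonoid (SpanClass S T) where
  add_assoc x y z := by
    induction x using ind with | _ A
    induction y using ind with | _ B
    induction z using ind with | _ C
    refine sound (Equiv.sumAssoc _ _ _) ?_ ?_ ?_
    · rintro g ((x | x) | x) <;> rfl
    · rintro ((x | x) | x) <;> rfl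
    · rintro ((x | x) | x) <;> rfl
  zero_add x := by
    induction x using ind with | _ A
    refine sound (Equiv.emptySum PEmpty _) ?_ ?_ ?_
    · rintro g (x | x)
      · exact x.elim
      · rfl
    · rintro (x | x)
      · exact x.elim
      · rfl
    · rintro (x | x)
      · exact x.elim
      · rfl
  add_zero x := by
    induction x using ind with | _ A
    refine sound (Equiv.sumEmpty _ PEmpty) ?_ ?_ ?_
    · rintro g (x | x)
      · rfl
      · exact x.elim
    · rintro (x | x)
      · rfl
      · exact x.elim
    · rintro (x | x)
      · rfl
      · exact x.elim
  add_comm x y := by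
    induction x using ind with | _ A
    induction y using ind with | _ B
    refine sound (Equiv.sumComm _ _) ?_ ?_ ?_
    · rintro g (x | x) <;> rfl
    · rintro (x | x) <;> rfl
    · rintro (x | x) <;> rfl
  nsmul := nsmulRec

/-- Composition on isomorphism classes. -/
def comp : SpanClass S T → SpanClass T U → SpanClass S U :=
  Quotient.map₂ Span.comp (by
    rintro A A' ⟨e, h1, h2, h3⟩ B B' ⟨f, k1, k2, k3⟩
    refine ⟨(Equiv.prodCongr e f).subtypeEquiv fun p => ?_, ?_, ?_, ?_⟩
    · simp [h3, k2]
    · rintro g ⟨⟨x, y⟩, hp⟩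
      exact Subtype.ext (Prod.ext (h1 g x) (k1 g y))
    · rintro ⟨⟨x, y⟩, hp⟩
      exact h2 x
    · rintro ⟨⟨x, y⟩, hp⟩
      exact k3 y)

/-- Cartesian product on isomorphism classes. -/
def prod : SpanClass S T → SpanClass S' T' → SpanClass (S.prod S') (T.prod T') :=
  Quotient.map₂ Span.prod (by
    rintro A A' ⟨e, h1, h2, h3⟩ B B' ⟨f, k1, k2, k3⟩
    refine ⟨Equiv.prodCongr e f, ?_, ?_, ?_⟩
    · rintro g ⟨x, y⟩
      exact Prod.ext (h1 g x) (k1 g y)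
    · rintro ⟨x, y⟩
      exact Prod.ext (h2 x) (k2 y)
    · rintro ⟨x, y⟩
      exact Prod.ext (h3 x) (k3 y))

/-- Composition as a biadditive map. -/
def compHom : SpanClass S T →+ SpanClass T U →+ SpanClass S U where
  toFun x :=
    { toFun := fun y => comp x y
      map_zero' := by
        induction x using ind with | _ A
        exact sound (Equiv.equivOfIsEmpty (α := {p : A.apex × PEmpty // _}) (β := PEmpty))
          (fun g x => x.1.2.elim) (fun x => x.1.2.elim) (fun x => x.1.2.elim)
      map_add' := by
        intro y z
        induction x using ind with | _ A
        induction y using ind with | _ B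
        induction z using ind with | _ C
        refine sound
          { toFun := fun p => match p with
              | ⟨(a, Sum.inl b), h⟩ => Sum.inl ⟨(a, b), h⟩
              | ⟨(a, Sum.inr c), h⟩ => Sum.inr ⟨(a, c), h⟩
            invFun := fun p => match p with
              | Sum.inl p => ⟨(p.1.1, Sum.inl p.1.2), p.2⟩
              | Sum.inr p => ⟨(p.1.1, Sum.inr p.1.2), p.2⟩
            left_inv := by rintro ⟨⟨a, b | c⟩, h⟩ <;> rfl
            right_inv := by rintro (p | p) <;> rfl } ?_ ?_ ?_
        · rintro g ⟨⟨a, b | c⟩, h⟩ <;> rfl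
        · rintro ⟨⟨a, b | c⟩, h⟩ <;> rfl
        · rintro ⟨⟨a, b | c⟩, h⟩ <;> rfl }
  map_zero' := by
    ext y
    induction y using ind with | _ B
    exact sound (Equiv.equivOfIsEmpty (α := {p : PEmpty × B.apex // _}) (β := PEmpty))
      (fun g x => x.1.1.elim) (fun x => x.1.1.elim) (fun x => x.1.1.elim)
  map_add' := by
    intro x y
    ext z
    induction x using ind with | _ A
    induction y using ind with | _ B
    induction z using ind with | _ C
    refine sound
      { toFun := fun p => match p with
          | ⟨(Sum.inl a, c), h⟩ => Sum.inl ⟨(a, c), h⟩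
          | ⟨(Sum.inr b, c), h⟩ => Sum.inr ⟨(b, c), h⟩
        invFun := fun p => match p with
          | Sum.inl p => ⟨(Sum.inl p.1.1, p.1.2), p.2⟩
          | Sum.inr p => ⟨(Sum.inr p.1.1, p.1.2), p.2⟩
        left_inv := by rintro ⟨⟨a | b, c⟩, h⟩ <;> rfl
        right_inv := by rintro (p | p) <;> rfl } ?_ ?_ ?_
    · rintro g ⟨⟨a | b, c⟩, h⟩ <;> rfl
    · rintro ⟨⟨a | b, c⟩, h⟩ <;> rfl
    · rintro ⟨⟨a | b, c⟩, h⟩ <;> rfl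

/-- Cartesian product as a biadditive map. -/
def prodHom : SpanClass S T →+ SpanClass S' T' →+ SpanClass (S.prod S') (T.prod T') where
  toFun x :=
    { toFun := fun y => prod x y
      map_zero' := by
        induction x using ind with | _ A
        exact sound (Equiv.equivOfIsEmpty (α := A.apex × PEmpty) (β := PEmpty))
          (fun g x => x.2.elim) (fun x => x.2.elim) (fun x => x.2.elim)
      map_add' := by
        intro y z
        induction x using ind with | _ A
        induction y using ind with | _ B
        induction z using ind with | _ C
        refine sound (Equiv.prodSumDistrib _ _ _) ?_ ?_ ?_
        · rintro g ⟨a, b | c⟩ <;> rfl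
        · rintro ⟨a, b | c⟩ <;> rfl
        · rintro ⟨a, b | c⟩ <;> rfl }
  map_zero' := by
    ext y
    induction y using ind with | _ B
    exact sound (Equiv.equivOfIsEmpty (α := PEmpty × B.apex) (β := PEmpty))
      (fun g x => x.1.elim) (fun x => x.1.elim) (fun x => x.1.elim)
  map_add' := by
    intro x y
    ext z
    induction x using ind with | _ A
    induction y using ind with | _ B
    induction z using ind with | _ C
    refine sound (Equiv.sumProdDistrib _ _ _) ?_ ?_ ?_
    · rintro g ⟨a | b, c⟩ <;> rfl
    · rintro ⟨a | b, c⟩ <;> rfl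
    · rintro ⟨a | b, c⟩ <;> rfl

theorem id_comp (x : SpanClass S T) : comp (mk (Span.graph (MulActionHom.id G))) x = x := by
  induction x using ind with | _ A
  refine sound
    { toFun := fun p => p.1.2
      invFun := fun a => ⟨(A.left a, a), rfl⟩
      left_inv := by rintro ⟨⟨s, a⟩, h⟩; exact Subtype.ext (Prod.ext h.symm rfl)
      right_inv := fun _ => rfl } (fun _ _ => rfl) ?_ (fun _ => rfl)
  rintro ⟨⟨s, a⟩, h⟩
  exact h.symm

theorem comp_id (x : SpanClass S T) : comp x (mk (Span.graph (MulActionHom.id G))) = x := by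
  induction x using ind with | _ A
  refine sound
    { toFun := fun p => p.1.1
      invFun := fun a => ⟨(a, A.right a), rfl⟩
      left_inv := by rintro ⟨⟨s, a⟩, h⟩; exact Subtype.ext (Prod.ext rfl h)
      right_inv := fun _ => rfl } (fun _ _ => rfl) (fun _ => rfl) ?_
  rintro ⟨⟨s, a⟩, h⟩
  exact h

theorem comp_assoc (x : SpanClass S T) (y : SpanClass T U) (z : SpanClass U V) :
    comp (comp x y) z = comp x (comp y z) := by
  induction x using ind with | _ A
  induction y using ind with | _ B
  induction z using ind with | _ C
  exact sound
    { toFun := fun p => ⟨(p.1.1.1.1, ⟨(p.1.1.1.2, p.1.2), p.2⟩), p.1.1.2⟩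
      invFun := fun p => ⟨(⟨(p.1.1, p.1.2.1.1), p.2⟩, p.1.2.1.2), p.1.2.2⟩
      left_inv := fun _ => rfl
      right_inv := fun _ => rfl } (fun _ _ => rfl) (fun _ => rfl) (fun _ => rfl)

theorem prod_id : prod (mk (Span.graph (MulActionHom.id G : S →[G] S)))
    (mk (Span.graph (MulActionHom.id G : S' →[G] S'))) =
      mk (Span.graph (MulActionHom.id G)) :=
  sound (Equiv.refl _) (fun _ _ => rfl) (fun _ => rfl) (fun _ => rfl)

theorem prod_comp (x : SpanClass S T) (y : SpanClass T U) (x' : SpanClass S' T')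
    (y' : SpanClass T' U') :
    prod (comp x y) (comp x' y') = comp (prod x x') (prod y y') := by
  induction x using ind with | _ A
  induction y using ind with | _ B
  induction x' using ind with | _ A'
  induction y' using ind with | _ B'
  exact sound
    { toFun := fun p => ⟨((p.1.1.1, p.2.1.1), (p.1.1.2, p.2.1.2)), Prod.ext p.1.2 p.2.2⟩
      invFun := fun p => (⟨(p.1.1.1, p.1.2.1), (Prod.ext_iff.1 p.2).1⟩,
        ⟨(p.1.1.2, p.1.2.2), (Prod.ext_iff.1 p.2).2⟩)
      left_inv := fun _ => rfl
      right_inv := fun _ => rfl } (fun _ _ => rfl) (fun _ => rfl) (fun _ => rfl)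

end SpanClass

open Algebra (GrothendieckAddGroup)

theorem grothendieck_induction {M : Type*} [AddCommMonoid M] {P : GrothendieckAddGroup M → Prop}
    (of : ∀ m, P (GrothendieckAddGroup.of m)) (sub : ∀ x y, P x → P y → P (x - y)) (x) : P x := by
  induction x using AddLocalization.ind with | _ p
  obtain ⟨a, b, hb⟩ := p
  have : AddLocalization.mk a ⟨b, hb⟩ =
      GrothendieckAddGroup.of a - GrothendieckAddGroup.of b := by
    rw [eq_sub_iff_add_eq]
    simp only [GrothendieckAddGroup.of]
    exact (AddLocalization.mk_eq_addMonoidOf_mk'_apply a ⟨b, hb⟩) ▸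
      AddSubmonoid.LocalizationMap.mk'_spec _ a ⟨b, hb⟩
  rw [this]
  exact sub _ _ (of a) (of b)

theorem lift_of {M P : Type*} [AddCommMonoid M] [AddCommGroup P]
    (f : M →+ P) (m : M) : GrothendieckAddGroup.lift f (GrothendieckAddGroup.of m) = f m :=
  DFunLike.congr_fun (GrothendieckAddGroup.lift.symm_apply_apply f) m

/-- The biadditive extension of a biadditive map to group completions. -/
def lift₂ {M N P : Type*} [AddCommMonoid M] [AddCommMonoid N] [AddCommGroup P]
    (f : M →+ N →+ P) : GrothendieckAddGroup M →+ GrothendieckAddGroup N →+ P :=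
  GrothendieckAddGroup.lift
    { toFun := fun m => GrothendieckAddGroup.lift (f m)
      map_zero' := by
        rw [← Equiv.eq_symm_apply, map_zero]; rfl
      map_add' := fun m m' => by
        rw [← Equiv.eq_symm_apply, map_add]
        exact DFunLike.ext _ _ fun n =>
          (congrArg₂ (· + ·) (lift_of (f m) n) (lift_of (f m') n)).symm }

theorem lift₂_of {M N P : Type*} [AddCommMonoid M] [AddCommMonoid N] [AddCommGroup P]
    (f : M →+ N →+ P) (m : M) (n : N) :
    lift₂ f (GrothendieckAddGroup.of m) (GrothendieckAddGroup.of n) = f m n := by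
  rw [lift₂, lift_of]
  exact lift_of (f m) n

/-- Morphisms of the Burnside category: the group completion of the monoid of isomorphism classes
of diagrams `S ← A → T`. -/
def Hom (S T : Burnside G) : Type (u + 1) := GrothendieckAddGroup (SpanClass S T)

instance (S T : Burnside G) : AddCommGroup (Hom S T) :=
  inferInstanceAs (AddCommGroup (GrothendieckAddGroup (SpanClass S T)))

variable {S T U V S' T' U' : Burnside G}

namespace Hom

/-- The morphism given by a diagram. -/
def of (A : Span S T) : Hom S T := GrothendieckAddGroup.of (SpanClass.mk A)

theorem ind {P : Hom S T → Prop} (hof : ∀ A, P (of A)) (hsub : ∀ x y, P x → P y → P (x - y))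
    (x : Hom S T) : P x :=
  grothendieck_induction (fun m => SpanClass.ind (P := fun m => P (GrothendieckAddGroup.of m))
    hof m) hsub x

/-- Extension of a map additive on diagrams to all morphisms. -/
def lift {P : Type*} [AddCommGroup P] (f : SpanClass S T →+ P) : Hom S T →+ P :=
  GrothendieckAddGroup.lift f

theorem lift_of {P : Type*} [AddCommGroup P] (f : SpanClass S T →+ P) (A : Span S T) :
    lift f (of A) = f (SpanClass.mk A) :=
  Burnside.lift_of _ _

/-- Composition. -/
def comp : Hom S T →+ Hom T U →+ Hom S U :=
  lift₂ ((AddMonoidHom.compHom GrothendieckAddGroup.of).comp SpanClass.compHom)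

/-- Cartesian product of morphisms. -/
def prod : Hom S T →+ Hom S' T' →+ Hom (S.prod S') (T.prod T') :=
  lift₂ ((AddMonoidHom.compHom GrothendieckAddGroup.of).comp SpanClass.prodHom)

theorem comp_of (A : Span S T) (B : Span T U) : comp (of A) (of B) = of (A.comp B) :=
  lift₂_of _ _ _

theorem prod_of (A : Span S T) (B : Span S' T') : prod (of A) (of B) = of (A.prod B) :=
  lift₂_of _ _ _

end Hom

instance : Category (Burnside G) where
  Hom := Hom
  id S := Hom.of (Span.graph (MulActionHom.id G))
  comp x y := Hom.comp x y
  id_comp x := by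
    induction x using Hom.ind with
    | hof A => rw [Hom.comp_of]; exact congrArg GrothendieckAddGroup.of (SpanClass.id_comp (.mk A))
    | hsub x y hx hy => rw [map_sub, hx, hy]
  comp_id x := by
    induction x using Hom.ind with
    | hof A => rw [Hom.comp_of]; exact congrArg GrothendieckAddGroup.of (SpanClass.comp_id (.mk A))
    | hsub x y hx hy => rw [map_sub, AddMonoidHom.sub_apply, hx, hy]
  assoc x y z := by
    induction x using Hom.ind with
    | hof A =>
      induction y using Hom.ind with
      | hof B =>
        induction z using Hom.ind with
        | hof C =>
          simp only [Hom.comp_of]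
          exact congrArg GrothendieckAddGroup.of (SpanClass.comp_assoc (.mk A) (.mk B) (.mk C))
        | hsub x y hx hy => simp only [map_sub, hx, hy]
      | hsub x y hx hy => simp only [map_sub, AddMonoidHom.sub_apply, hx, hy]
    | hsub x y hx hy => simp only [map_sub, AddMonoidHom.sub_apply, hx, hy]

instance : Preadditive (Burnside G) where
  homGroup S T := inferInstanceAs (AddCommGroup (Hom S T))
  add_comp S T U (f f' : Hom S T) (g : Hom T U) :=
    DFunLike.congr_fun (map_add (Hom.comp : Hom S T →+ Hom T U →+ Hom S U) f f') g
  comp_add S T U (f : Hom S T) (g g' : Hom T U) :=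
    map_add (Hom.comp f : Hom T U →+ Hom S U) g g'

/-- The cartesian product functor on the Burnside category. -/
def prodFunctor (G : Type u) [Group G] : Burnside G × Burnside G ⥤ Burnside G where
  obj X := X.1.prod X.2
  map f := Hom.prod f.1 f.2
  map_id X := (Hom.prod_of _ _).trans (congrArg GrothendieckAddGroup.of SpanClass.prod_id)
  map_comp := by
    rintro ⟨S, S'⟩ ⟨T, T'⟩ ⟨U, U'⟩ ⟨x, x'⟩ ⟨y, y'⟩
    change Hom.prod (Hom.comp x y) (Hom.comp x' y') = Hom.comp (Hom.prod x x') (Hom.prod y y')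
    induction x using Hom.ind with
    | hof A =>
      induction x' using Hom.ind with
      | hof A' =>
        induction y using Hom.ind with
        | hof B =>
          induction y' using Hom.ind with
          | hof B' =>
            simp only [Hom.comp_of, Hom.prod_of]
            exact congrArg GrothendieckAddGroup.of
              (SpanClass.prod_comp (.mk A) (.mk B) (.mk A') (.mk B'))
          | hsub x y hx hy => simp only [map_sub, hx, hy]
        | hsub x y hx hy => simp only [map_sub, AddMonoidHom.sub_apply, hx, hy]
      | hsub x y hx hy => simp only [map_sub, AddMonoidHom.sub_apply, hx, hy]
    | hsub x y hx hy => simp only [map_sub, AddMonoidHom.sub_apply, hx, hy]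

/-- The covariant functoriality of the Burnside category in equivariant maps. -/
def graph (f : S →[G] T) : S ⟶ T := Hom.of (Span.graph f)

/-- The associativity map `(S × T) × U → S × (T × U)`. -/
def assoc (S T U : Burnside G) : (S.prod T).prod U →[G] S.prod (T.prod U) :=
  ⟨fun p => (p.1.1, (p.1.2, p.2)), fun _ _ => rfl⟩

/-- The swap map `S × T → T × S`. -/
def swap (S T : Burnside G) : S.prod T →[G] T.prod S :=
  ⟨fun p => (p.2, p.1), fun _ _ => rfl⟩

/-- The projection `S × G/G → S`. -/
def rightUnit (S : Burnside G) : S.prod (point G) →[G] S :=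
  ⟨fun p => p.1, fun _ _ => rfl⟩

end Burnside

open Burnside

variable {G : Type u} [Group G]

section FixedPoints

theorem finsum_sumType {α β M : Type*} [Finite α] [Finite β] [AddCommMonoid M] (f : α ⊕ β → M) :
    ∑ᶠ x, f x = ∑ᶠ a, f (Sum.inl a) + ∑ᶠ b, f (Sum.inr b) := by
  cases nonempty_fintype α
  cases nonempty_fintype β
  simp only [finsum_eq_sum_of_fintype, Fintype.sum_sum_type]

theorem finsum_sigmaType {α M : Type*} {β : α → Type*} [Finite α] [∀ a, Finite (β a)]
    [AddCommMonoid M] (f : (Σ a, β a) → M) : ∑ᶠ x, f x = ∑ᶠ a, ∑ᶠ b, f ⟨a, b⟩ := by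
  cases nonempty_fintype α
  have := fun a => Fintype.ofFinite (β a)
  simp only [finsum_eq_sum_of_fintype, Fintype.sum_sigma]

theorem finsum_prodType {α β M : Type*} [Finite α] [Finite β] [AddCommMonoid M] (f : α × β → M) :
    ∑ᶠ x, f x = ∑ᶠ b, ∑ᶠ a, f (a, b) := by
  cases nonempty_fintype α
  cases nonempty_fintype β
  simp only [finsum_eq_sum_of_fintype, Fintype.sum_prod_type_right]

variable {V : Type v} [AddCommGroup V] (ρ : G →* AddMonoid.End V)

/-- The trivial action of `G` on the abelian group `ℤ`. -/
def trivialAction (G : Type u) [Group G] : G →* AddMonoid.End ℤ := 1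

/-- The group `Map_G(S, V)` of equivariant maps from `S` to a `ℤ[G]`-module `V`. For `S = G/H` this
is the group `V^H` of `H`-fixed points. -/
def equivariantMaps (S : Burnside G) : AddSubgroup (S → V) where
  carrier := {f | ∀ (g : G) (s : S), f (g • s) = ρ g (f s)}
  zero_mem' := fun _ _ => (map_zero _).symm
  add_mem' := fun {a b} ha hb g s => by simp only [Pi.add_apply, ha g s, hb g s, map_add]
  neg_mem' := fun {a} ha g s => by simp only [Pi.neg_apply, ha g s, map_neg]

variable {S T U S' T' : Burnside G}

/-- The action of a diagram `S ← A → T` on equivariant maps: pull back to `A` and then sum over the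
fibres of `A → T`. -/
def spanMap (A : Span S T) : equivariantMaps ρ S →+ equivariantMaps ρ T where
  toFun f := ⟨fun t => ∑ᶠ a : {a : A.apex // A.right a = t}, f.1 (A.left a), fun g t => by
    beta_reduce
    rw [map_finsum (ρ g) (Set.toFinite _), ← finsum_comp_equiv
      (⟨fun a => ⟨g • a.1, by rw [map_smul, a.2]⟩, fun a => ⟨g⁻¹ • a.1, by
        rw [map_smul, a.2, inv_smul_smul]⟩, fun a => by simp, fun a => by simp⟩ :
        {a : A.apex // A.right a = t} ≃ {a : A.apex // A.right a = g • t})]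
    refine finsum_congr fun a => ?_
    simp only [Equiv.coe_fn_mk, map_smul]
    exact f.2 g _⟩
  map_zero' := Subtype.ext (funext fun t => by simp)
  map_add' f f' := Subtype.ext (funext fun t =>
    finsum_add_distrib (Set.toFinite _) (Set.toFinite _))

theorem spanMap_congr {A B : Span S T} (h : A ≈ B) : spanMap ρ A = spanMap ρ B := by
  obtain ⟨e, h1, h2, h3⟩ := h
  refine DFunLike.ext _ _ fun f => Subtype.ext (funext fun t => ?_)
  change ∑ᶠ a : {a : A.apex // A.right a = t}, f.1 (A.left a) =
    ∑ᶠ a : {a : B.apex // B.right a = t}, f.1 (B.left a)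
  rw [← finsum_comp_equiv (e.subtypeEquiv fun a => by rw [h3] :
    {a : A.apex // A.right a = t} ≃ {a : B.apex // B.right a = t})]
  exact finsum_congr fun a => by rw [Equiv.subtypeEquiv_apply, h2]

/-- The action of isomorphism classes of diagrams on equivariant maps. -/
def spanClassMap (S T : Burnside G) :
    SpanClass S T →+ equivariantMaps ρ S →+ equivariantMaps ρ T where
  toFun := Quotient.lift (spanMap ρ) fun _ _ h => spanMap_congr ρ h
  map_zero' := by
    refine DFunLike.ext _ _ fun f => Subtype.ext (funext fun t => ?_)
    have : IsEmpty {a : (Span.empty S T).apex // (Span.empty S T).right a = t} :=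
      ⟨fun a => PEmpty.elim a.1⟩
    exact finsum_of_isEmpty _
  map_add' x y := by
    induction x using SpanClass.ind with | _ A
    induction y using SpanClass.ind with | _ B
    refine DFunLike.ext _ _ fun f => Subtype.ext (funext fun t => ?_)
    change ∑ᶠ a : {a : A.apex ⊕ B.apex // Sum.elim A.right B.right a = t},
      f.1 (Sum.elim A.left B.left a.1) = (∑ᶠ a : {a : A.apex // A.right a = t}, f.1 (A.left a)) +
        ∑ᶠ a : {a : B.apex // B.right a = t}, f.1 (B.left a)
    rw [← finsum_comp_equiv (Equiv.subtypeSum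
      (p := fun a => Sum.elim A.right B.right a = t)).symm, finsum_sumType]
    rfl

/-- The action of the morphisms of the Burnside category on equivariant maps. -/
def homMap (S T : Burnside G) : Burnside.Hom S T →+ equivariantMaps ρ S →+ equivariantMaps ρ T :=
  Burnside.Hom.lift (spanClassMap ρ S T)

theorem homMap_of (A : Span S T) : homMap ρ S T (Burnside.Hom.of A) = spanMap ρ A :=
  Burnside.Hom.lift_of _ _

theorem spanMap_graph_apply (f : S →[G] T) (x : equivariantMaps ρ S) (t : T) :
    (spanMap ρ (Span.graph f) x).1 t = ∑ᶠ s : {s : S // f s = t}, x.1 s := rfl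

theorem spanMap_equiv (f : S →[G] T) (e : T → S) (h : ∀ s, e (f s) = s) (h' : ∀ t, f (e t) = t)
    (x : equivariantMaps ρ S) (t : T) : (spanMap ρ (Span.graph f) x).1 t = x.1 (e t) := by
  rw [spanMap_graph_apply]
  let _ : Unique {s : S // f s = t} :=
    { default := ⟨e t, h' t⟩
      uniq := fun s => Subtype.ext (by rw [← h s.1, s.2]) }
  exact finsum_unique (fun s : {s : S // f s = t} => x.1 s)

theorem graph_id (S : Burnside G) : graph (MulActionHom.id G : S →[G] S) = 𝟙 S := rfl

theorem homMap_graph_equiv (f : S →[G] T) (e : T → S) (h : ∀ s, e (f s) = s)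
    (h' : ∀ t, f (e t) = t) (x : equivariantMaps ρ S) (y : equivariantMaps ρ T)
    (hxy : ∀ t, x.1 (e t) = y.1 t) : homMap ρ S T (graph f) x = y := by
  refine Subtype.ext (funext fun t => ?_)
  rw [graph, homMap_of, spanMap_equiv ρ f e h h', hxy]

theorem spanMap_comp (A : Span S T) (B : Span T U) :
    spanMap ρ (A.comp B) = (spanMap ρ B).comp (spanMap ρ A) := by
  refine DFunLike.ext _ _ fun f => Subtype.ext (funext fun t => ?_)
  change ∑ᶠ p : {p : {p : A.apex × B.apex // A.right p.1 = B.left p.2} // B.right p.1.2 = t},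
    f.1 (A.left p.1.1.1) = ∑ᶠ b : {b : B.apex // B.right b = t},
      ∑ᶠ a : {a : A.apex // A.right a = B.left b}, f.1 (A.left a)
  rw [← finsum_sigmaType (fun p : Σ b : {b : B.apex // B.right b = t},
    {a : A.apex // A.right a = B.left b} => f.1 (A.left p.2))]
  exact finsum_comp_equiv (f := fun p : Σ b : {b : B.apex // B.right b = t},
    {a : A.apex // A.right a = B.left b} => f.1 (A.left p.2))
    (⟨fun p => ⟨⟨p.1.1.2, p.2⟩, ⟨p.1.1.1, p.1.2⟩⟩, fun p => ⟨⟨(p.2.1, p.1.1), p.2.2⟩, p.1.2⟩,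
      fun _ => rfl, fun _ => rfl⟩ :
      {p : {p : A.apex × B.apex // A.right p.1 = B.left p.2} // B.right p.1.2 = t} ≃
      Σ b : {b : B.apex // B.right b = t}, {a : A.apex // A.right a = B.left b})

/-- The fixed point Mackey functor of a `ℤ[G]`-module `V`, which sends `G/H` to `V^H`. Restrictions
are inclusions of fixed points and corestrictions are sums over cosets. -/
def fixedPointFunctor : Burnside G ⥤ AddCommGrpCat.{max u v} where
  obj S := AddCommGrpCat.of (equivariantMaps ρ S)
  map {S T} x := AddCommGrpCat.ofHom (homMap ρ S T x)
  map_id S := congrArg AddCommGrpCat.ofHom (DFunLike.ext _ _ fun x => by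
    rw [← graph_id]
    exact homMap_graph_equiv ρ _ id (fun _ => rfl) (fun _ => rfl) x x fun _ => rfl)
  map_comp {S T U} x y := by
    have key : ∀ (x : Burnside.Hom S T) (y : Burnside.Hom T U),
        homMap ρ S U (Burnside.Hom.comp x y) = (homMap ρ T U y).comp (homMap ρ S T x) := by
      intro x y
      induction x using Burnside.Hom.ind with
      | hof A =>
        induction y using Burnside.Hom.ind with
        | hof B => rw [Burnside.Hom.comp_of, homMap_of, homMap_of, homMap_of, spanMap_comp]
        | hsub x y hx hy => rw [map_sub, map_sub, hx, hy, map_sub, AddMonoidHom.sub_comp]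
      | hsub x y hx hy =>
        rw [map_sub, AddMonoidHom.sub_apply, map_sub, hx, hy, map_sub, AddMonoidHom.comp_sub]
    exact congrArg AddCommGrpCat.ofHom (key x y)

instance : (fixedPointFunctor ρ).Additive where
  map_add {S T} x y := congrArg AddCommGrpCat.ofHom
    (map_add (homMap ρ S T) (x : Burnside.Hom S T) y)

/-- The pairing `Map_G(S, V) × Map_G(T, ℤ) → Map_G(S × T, V)`. -/
def pairing (S T : Burnside G) :
    equivariantMaps ρ S →+ equivariantMaps (trivialAction G) T →+
      equivariantMaps ρ (S.prod T) where
  toFun f :=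
    { toFun := fun r => ⟨fun p => r.1 p.2 • f.1 p.1, fun g p => by
        change r.1 (g • p.2) • f.1 (g • p.1) = _
        rw [f.2, r.2, map_zsmul]
        rfl⟩
      map_zero' := Subtype.ext (funext fun p => zero_smul ℤ _)
      map_add' := fun r r' => Subtype.ext (funext fun p => add_smul _ _ _) }
  map_zero' := DFunLike.ext _ _ fun r => Subtype.ext (funext fun p => smul_zero (r.1 p.2))
  map_add' f f' := DFunLike.ext _ _ fun r =>
    Subtype.ext (funext fun p => smul_add (r.1 p.2) (f.1 p.1) (f'.1 p.1))

theorem pairing_natural (x : Burnside.Hom S S') (y : Burnside.Hom T T')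
    (f : equivariantMaps ρ S) (r : equivariantMaps (trivialAction G) T) :
    homMap ρ _ _ (Burnside.Hom.prod x y) (pairing ρ S T f r) =
      pairing ρ S' T' (homMap ρ _ _ x f) (homMap _ _ _ y r) := by
  induction x using Burnside.Hom.ind with
  | hof A =>
    induction y using Burnside.Hom.ind with
    | hof B =>
      rw [Burnside.Hom.prod_of, homMap_of, homMap_of, homMap_of]
      refine Subtype.ext (funext fun ⟨s, t⟩ => ?_)
      change ∑ᶠ p : {p : A.apex × B.apex // (A.right p.1, B.right p.2) = (s, t)},
        r.1 (B.left p.1.2) • f.1 (A.left p.1.1) =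
          (∑ᶠ b : {b : B.apex // B.right b = t}, r.1 (B.left b)) •
            ∑ᶠ a : {a : A.apex // A.right a = s}, f.1 (A.left a)
      rw [← finsum_comp_equiv
        (⟨fun p => ⟨(p.1.1, p.2.1), Prod.ext p.1.2 p.2.2⟩,
          fun p => (⟨p.1.1, (Prod.ext_iff.1 p.2).1⟩, ⟨p.1.2, (Prod.ext_iff.1 p.2).2⟩),
          fun _ => rfl, fun _ => rfl⟩ :
          {a : A.apex // A.right a = s} × {b : B.apex // B.right b = t} ≃
          {p : A.apex × B.apex // (A.right p.1, B.right p.2) = (s, t)}), finsum_prodType]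
      cases nonempty_fintype {a : A.apex // A.right a = s}
      cases nonempty_fintype {b : B.apex // B.right b = t}
      simp only [finsum_eq_sum_of_fintype, Finset.sum_smul]
      refine Finset.sum_congr rfl fun b _ => ?_
      rw [Finset.smul_sum]
      rfl
    | hsub x y hx hy => simp only [map_sub, AddMonoidHom.sub_apply, hx, hy]
  | hsub x y hx hy => simp only [map_sub, AddMonoidHom.sub_apply, hx, hy]

theorem pairing_one (f : equivariantMaps ρ S) :
    homMap ρ _ _ (graph (rightUnit S)) (pairing ρ S (point G) f ⟨fun _ => 1, fun _ _ => rfl⟩) =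
      f :=
  homMap_graph_equiv ρ (rightUnit S) (fun s : S => (s, PUnit.unit)) (fun _ => rfl) (fun _ => rfl)
    _ _ fun s => one_smul ℤ (f.1 s)

theorem pairing_assoc (f : equivariantMaps ρ S)
    (r : equivariantMaps (trivialAction G) T)
    (r' : equivariantMaps (trivialAction G) U) :
    homMap ρ _ _ (graph (assoc S T U)) (pairing ρ (S.prod T) U (pairing ρ S T f r) r') =
      pairing ρ S (T.prod U) f (pairing _ T U r r') :=
  homMap_graph_equiv ρ (assoc S T U) (fun p : S × (T × U) => ((p.1, p.2.1), p.2.2)) (fun _ => rfl)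
    (fun _ => rfl) _ _ fun p => (mul_smul (r'.1 p.2.2) (r.1 p.2.1) (f.1 p.1)).symm

theorem pairing_comm (r : equivariantMaps (trivialAction G) S)
    (r' : equivariantMaps (trivialAction G) T) :
    homMap _ _ _ (graph (swap S T)) (pairing _ S T r r') = pairing _ T S r' r :=
  homMap_graph_equiv _ (swap S T) (fun p : T × S => (p.2, p.1)) (fun _ => rfl) (fun _ => rfl)
    _ _ fun p => mul_comm (r'.1 p.1) (r.1 p.2)

end FixedPoints

section Green

/-- A Green functor: a commutative monoid for the box product of Mackey functors (additive functors
on the Burnside category). Since the box product is the left Kan extension of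
`(S, T) ↦ R(S) ⊗ R(T)` along the cartesian product functor, a morphism `R □ R → R` is given here as
the corresponding natural family of biadditive maps `R(S) × R(T) → R(S × T)`; since the
unit of the box product is represented by `G/G`, the unit is an element of `R(G/G)`. -/
structure GreenFunctor (G : Type u) [Group G] where
  functor : Burnside G ⥤ AddCommGrpCat.{u}
  [additive : functor.Additive]
  mul (S T : Burnside G) : functor.obj S →+ functor.obj T →+ functor.obj (S.prod T)
  mul_natural {S S' T T' : Burnside G} (x : S ⟶ S') (y : T ⟶ T')
    (a : functor.obj S) (b : functor.obj T) :
    functor.map ((prodFunctor G).map (Prod.mkHom x y)) (mul S T a b) =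
      mul S' T' (functor.map x a) (functor.map y b)
  one : functor.obj (point G)
  mul_one {S : Burnside G} (a : functor.obj S) :
    functor.map (graph (rightUnit S)) (mul S (point G) a one) = a
  mul_assoc {S T U : Burnside G} (a : functor.obj S) (b : functor.obj T) (c : functor.obj U) :
    functor.map (graph (assoc S T U)) (mul (S.prod T) U (mul S T a b) c) =
      mul S (T.prod U) a (mul T U b c)
  mul_comm {S T : Burnside G} (a : functor.obj S) (b : functor.obj T) :
    functor.map (graph (swap S T)) (mul S T a b) = mul T S b a

attribute [instance] GreenFunctor.additive

/-- The constant Green functor `ℤ`: the fixed point Mackey functor of the trivial `ℤ[G]`-module `ℤ`,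
with multiplication of integers. -/
def constantGreen (G : Type u) [Group G] : GreenFunctor G where
  functor := fixedPointFunctor (trivialAction G)
  mul S T := pairing (trivialAction G) S T
  mul_natural x y a b := pairing_natural _ x y a b
  one := ⟨fun _ => 1, fun _ _ => rfl⟩
  mul_one a := pairing_one _ a
  mul_assoc a b c := pairing_assoc _ a b c
  mul_comm a b := pairing_comm a b

/-- A (right) module over a Green functor `R`: a Mackey functor `M` with an associative and unital
action `M □ R → M`, given as the corresponding natural family of biadditive maps
`M(S) × R(T) → M(S × T)`. -/
structure MackeyModule (R : GreenFunctor G) where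
  functor : Burnside G ⥤ AddCommGrpCat.{u}
  [additive : functor.Additive]
  act (S T : Burnside G) : functor.obj S →+ R.functor.obj T →+ functor.obj (S.prod T)
  act_natural {S S' T T' : Burnside G} (x : S ⟶ S') (y : T ⟶ T')
    (m : functor.obj S) (r : R.functor.obj T) :
    functor.map ((prodFunctor G).map (Prod.mkHom x y)) (act S T m r) =
      act S' T' (functor.map x m) (R.functor.map y r)
  act_one {S : Burnside G} (m : functor.obj S) :
    functor.map (graph (rightUnit S)) (act S (point G) m R.one) = m
  act_assoc {S T U : Burnside G} (m : functor.obj S) (r : R.functor.obj T)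
    (r' : R.functor.obj U) :
    functor.map (graph (assoc S T U)) (act (S.prod T) U (act S T m r) r') =
      act S (T.prod U) m (R.mul T U r r')

end Green

section Modules

open Limits

attribute [instance] MackeyModule.additive

namespace MackeyModule

variable {R : GreenFunctor G}

/-- A morphism of modules: a natural transformation compatible with the actions. -/
@[ext]
structure Hom (M N : MackeyModule R) where
  app : M.functor ⟶ N.functor
  app_act {S T : Burnside G} (m : M.functor.obj S) (r : R.functor.obj T) :
    app.app (S.prod T) (M.act S T m r) = N.act S T (app.app S m) r

instance : Category (MackeyModule R) where
  Hom := Hom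
  id M := ⟨𝟙 _, fun _ _ => rfl⟩
  comp f g := ⟨f.app ≫ g.app, fun m r =>
    (congrArg (g.app.app _) (f.app_act m r)).trans (g.app_act _ r)⟩

variable {M N P : MackeyModule R}

theorem hom_ext {f g : M ⟶ N} (h : ∀ S (m : M.functor.obj S), f.app.app S m = g.app.app S m) :
    f = g := by
  apply Hom.ext
  ext S m
  exact h S m

theorem comp_app_apply (f : M ⟶ N) (g : N ⟶ P) (S : Burnside G) (m : M.functor.obj S) :
    (f ≫ g).app.app S m = g.app.app S (f.app.app S m) := rfl

theorem id_app_apply (S : Burnside G) (m : M.functor.obj S) :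
    (Hom.app (𝟙 M)).app S m = m := rfl

theorem naturality_apply (f : M ⟶ N) {S T : Burnside G} (x : S ⟶ T) (m : M.functor.obj S) :
    f.app.app T (M.functor.map x m) = N.functor.map x (f.app.app S m) :=
  NatTrans.naturality_apply f.app x m

instance : Zero (M ⟶ N) := ⟨⟨0, fun m r => by
  change (0 : N.functor.obj _) = N.act _ _ (0 : N.functor.obj _) r
  rw [map_zero, AddMonoidHom.zero_apply]⟩⟩

instance : Add (M ⟶ N) := ⟨fun f g => ⟨f.app + g.app, fun m r => by
  change f.app.app _ (M.act _ _ m r) + g.app.app _ (M.act _ _ m r) =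
    N.act _ _ (f.app.app _ m + g.app.app _ m) r
  rw [map_add, AddMonoidHom.add_apply, f.app_act, g.app_act]⟩⟩

instance : Neg (M ⟶ N) := ⟨fun f => ⟨-f.app, fun m r => by
  change -f.app.app _ (M.act _ _ m r) = N.act _ _ (-f.app.app _ m) r
  rw [map_neg, AddMonoidHom.neg_apply, f.app_act]⟩⟩

theorem zero_app_apply (S : Burnside G) (m : M.functor.obj S) :
    (0 : M ⟶ N).app.app S m = 0 := rfl

theorem add_app_apply (f g : M ⟶ N) (S : Burnside G) (m : M.functor.obj S) :
    (f + g).app.app S m = f.app.app S m + g.app.app S m := rfl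

theorem neg_app_apply (f : M ⟶ N) (S : Burnside G) (m : M.functor.obj S) :
    (-f).app.app S m = -f.app.app S m := rfl

instance : AddCommGroup (M ⟶ N) where
  add_assoc f g h := Hom.ext (add_assoc f.app g.app h.app)
  zero_add f := Hom.ext (zero_add f.app)
  add_zero f := Hom.ext (add_zero f.app)
  add_comm f g := Hom.ext (add_comm f.app g.app)
  neg_add_cancel f := Hom.ext (neg_add_cancel f.app)
  nsmul := nsmulRec
  zsmul := zsmulRec

instance : Preadditive (MackeyModule R) where
  add_comp _ _ _ f f' g := Hom.ext (Preadditive.add_comp _ _ _ f.app f'.app g.app)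
  comp_add _ _ _ f g g' := Hom.ext (Preadditive.comp_add _ _ _ f.app g.app g'.app)

/-- Constructor for modules from elementwise data. -/
def ofData (X : Burnside G → Type u) [∀ S, AddCommGroup (X S)]
    (map : ∀ {S T : Burnside G}, (S ⟶ T) → X S →+ X T)
    (act : ∀ S T : Burnside G, X S →+ R.functor.obj T →+ X (S.prod T))
    (map_id : ∀ S (a : X S), map (𝟙 S) a = a)
    (map_comp : ∀ {S T U : Burnside G} (x : S ⟶ T) (y : T ⟶ U) (a : X S),
      map (x ≫ y) a = map y (map x a))
    (map_add : ∀ {S T : Burnside G} (x y : S ⟶ T) (a : X S), map (x + y) a = map x a + map y a)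
    (act_natural : ∀ {S S' T T' : Burnside G} (x : S ⟶ S') (y : T ⟶ T') (m : X S)
      (r : R.functor.obj T), map ((prodFunctor G).map (Prod.mkHom x y)) (act S T m r) =
        act S' T' (map x m) (R.functor.map y r))
    (act_one : ∀ {S : Burnside G} (m : X S),
      map (graph (rightUnit S)) (act S (point G) m R.one) = m)
    (act_assoc : ∀ {S T U : Burnside G} (m : X S) (r : R.functor.obj T) (r' : R.functor.obj U),
      map (graph (assoc S T U)) (act (S.prod T) U (act S T m r) r') =
        act S (T.prod U) m (R.mul T U r r')) :
    MackeyModule R where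
  functor :=
    { obj := fun S => AddCommGrpCat.of (X S)
      map := fun x => AddCommGrpCat.ofHom (map x)
      map_id := fun S => congrArg AddCommGrpCat.ofHom (DFunLike.ext _ _ (map_id S))
      map_comp := fun x y => congrArg AddCommGrpCat.ofHom (DFunLike.ext _ _ (map_comp x y)) }
  additive :=
    ⟨fun {_ _ x y} => congrArg AddCommGrpCat.ofHom (DFunLike.ext _ _ (map_add x y))⟩
  act := act
  act_natural := act_natural
  act_one := act_one
  act_assoc := act_assoc

/-- Constructor for morphisms from elementwise data. -/
def homMk (φ : ∀ S, M.functor.obj S →+ N.functor.obj S)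
    (naturality : ∀ {S T : Burnside G} (x : S ⟶ T) (m : M.functor.obj S),
      φ T (M.functor.map x m) = N.functor.map x (φ S m))
    (app_act : ∀ {S T : Burnside G} (m : M.functor.obj S) (r : R.functor.obj T),
      φ (S.prod T) (M.act S T m r) = N.act S T (φ S m) r) : M ⟶ N where
  app :=
    { app := fun S => AddCommGrpCat.ofHom (φ S)
      naturality := fun S T x => by
        ext m
        exact naturality x m }
  app_act := app_act

theorem map_id_apply (S : Burnside G) (m : M.functor.obj S) : M.functor.map (𝟙 S) m = m := by
  simp

theorem map_comp_apply {S T U : Burnside G} (x : S ⟶ T) (y : T ⟶ U) (m : M.functor.obj S) :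
    M.functor.map (x ≫ y) m = M.functor.map y (M.functor.map x m) := by
  simp

theorem map_add_apply {S T : Burnside G} (x y : S ⟶ T) (m : M.functor.obj S) :
    M.functor.map (x + y) m = M.functor.map x m + M.functor.map y m := by
  rw [Functor.map_add]
  rfl

/-- The zero module. -/
def zero (R : GreenFunctor G) : MackeyModule R :=
  ofData (fun _ => PUnit) (fun _ => 0) (fun _ _ => 0) (fun _ _ => rfl) (fun _ _ _ => rfl)
    (fun _ _ _ => rfl) (fun _ _ _ _ => rfl) (fun _ => rfl) (fun _ _ _ => rfl)

instance : HasTerminal (MackeyModule R) :=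
  IsTerminal.hasTerminal (X := zero R) (IsTerminal.ofUniqueHom (fun _ => 0)
    fun _ _ => hom_ext fun _ _ => rfl)

/-- The product of two modules. -/
def prod (M N : MackeyModule R) : MackeyModule R :=
  ofData (fun S => M.functor.obj S × N.functor.obj S)
    (fun x => (M.functor.map x).hom.prodMap (N.functor.map x).hom)
    (fun S T =>
      { toFun := fun m => (M.act S T m.1).prod (N.act S T m.2)
        map_zero' := by ext r <;> simp
        map_add' := fun m n => by ext r <;> simp })
    (fun S a => Prod.ext (map_id_apply S a.1) (map_id_apply S a.2))
    (fun x y a => Prod.ext (map_comp_apply x y a.1) (map_comp_apply x y a.2))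
    (fun x y a => Prod.ext (map_add_apply x y a.1) (map_add_apply x y a.2))
    (fun x y m r => Prod.ext (M.act_natural x y m.1 r) (N.act_natural x y m.2 r))
    (fun m => Prod.ext (M.act_one m.1) (N.act_one m.2))
    (fun m r r' => Prod.ext (M.act_assoc m.1 r r') (N.act_assoc m.2 r r'))

/-- The first projection. -/
def prodFst (M N : MackeyModule R) : prod M N ⟶ M :=
  homMk (fun S => AddMonoidHom.fst (M.functor.obj S) (N.functor.obj S)) (fun _ _ => rfl)
    fun _ _ => rfl

/-- The second projection. -/
def prodSnd (M N : MackeyModule R) : prod M N ⟶ N :=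
  homMk (fun S => AddMonoidHom.snd (M.functor.obj S) (N.functor.obj S)) (fun _ _ => rfl)
    fun _ _ => rfl

/-- The morphism to a product. -/
def prodLift (f : P ⟶ M) (g : P ⟶ N) : P ⟶ prod M N :=
  homMk (fun S => (f.app.app S).hom.prod (g.app.app S).hom)
    (fun x m => Prod.ext (naturality_apply f x m) (naturality_apply g x m))
    (fun m r => Prod.ext (f.app_act m r) (g.app_act m r))

instance : HasBinaryProducts (MackeyModule R) :=
  have (M N : MackeyModule R) : HasLimit (pair M N) :=
    HasLimit.mk ⟨BinaryFan.mk (prodFst M N) (prodSnd M N), BinaryFan.isLimitMk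
      (fun s => prodLift s.fst s.snd) (fun _ => rfl) (fun _ => rfl)
      (fun s m h1 h2 => by
        rw [← h1, ← h2]
        rfl)⟩
  hasBinaryProducts_of_hasLimit_pair _

instance : HasFiniteProducts (MackeyModule R) := hasFiniteProducts_of_has_binary_and_terminal

/-- The kernel of a morphism, computed objectwise. -/
def ker (f : M ⟶ N) : MackeyModule R :=
  ofData (fun S => (f.app.app S).hom.ker)
    (fun x => ((M.functor.map x).hom.comp (AddSubgroup.subtype _)).codRestrict _ fun m => by
      change f.app.app _ (M.functor.map x m.1) = 0
      rw [naturality_apply, show f.app.app _ m.1 = 0 from m.2, map_zero])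
    (fun S T =>
      { toFun := fun m => (M.act S T m.1).codRestrict _ fun r => by
          change f.app.app _ (M.act S T m.1 r) = 0
          rw [f.app_act, show f.app.app _ m.1 = 0 from m.2, map_zero, AddMonoidHom.zero_apply]
        map_zero' := DFunLike.ext _ _ fun r => Subtype.ext (by
          change M.act S T 0 r = 0
          rw [map_zero, AddMonoidHom.zero_apply])
        map_add' := fun m n => DFunLike.ext _ _ fun r => Subtype.ext (by
          change M.act S T (m.1 + n.1) r = M.act S T m.1 r + M.act S T n.1 r
          rw [map_add, AddMonoidHom.add_apply]) })
    (fun S a => Subtype.ext (map_id_apply S a.1))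
    (fun x y a => Subtype.ext (map_comp_apply x y a.1))
    (fun x y a => Subtype.ext (map_add_apply x y a.1))
    (fun x y m r => Subtype.ext (M.act_natural x y m.1 r))
    (fun m => Subtype.ext (M.act_one m.1))
    (fun m r r' => Subtype.ext (M.act_assoc m.1 r r'))

/-- The inclusion of the kernel. -/
def kerι (f : M ⟶ N) : ker f ⟶ M :=
  homMk (fun S => AddSubgroup.subtype (f.app.app S).hom.ker) (fun _ _ => rfl) fun _ _ => rfl

theorem kerι_comp (f : M ⟶ N) : kerι f ≫ f = 0 := hom_ext fun _ m => m.2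

/-- The factorization through the kernel. -/
def kerLift (f : M ⟶ N) (k : P ⟶ M) (h : k ≫ f = 0) : P ⟶ ker f :=
  homMk (fun S => (k.app.app S).hom.codRestrict (f.app.app S).hom.ker fun p => by
      change (k ≫ f).app.app S p = 0
      rw [h]
      rfl)
    (fun x m => Subtype.ext (naturality_apply k x m))
    (fun m r => Subtype.ext (k.app_act m r))

instance : HasKernels (MackeyModule R) where
  has_limit f := HasLimit.mk ⟨KernelFork.ofι (kerι f) (kerι_comp f),
    KernelFork.IsLimit.ofι _ _ (fun k hk => kerLift f k hk) (fun _ _ => rfl)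
      (fun k hk m hm => hom_ext fun S p => Subtype.ext (by
        subst hm
        rfl))⟩

/-- The cokernel of a morphism, computed objectwise. -/
def coker (f : M ⟶ N) : MackeyModule R :=
  ofData (fun S => N.functor.obj S ⧸ (f.app.app S).hom.range)
    (fun {S T} x => QuotientAddGroup.map _ _ (N.functor.map x).hom (by
      rintro _ ⟨m, rfl⟩
      exact ⟨M.functor.map x m, naturality_apply f x m⟩))
    (fun S T => QuotientAddGroup.lift _
      ((AddMonoidHom.compHom (QuotientAddGroup.mk' (f.app.app (S.prod T)).hom.range)).comp
        (N.act S T)) (by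
      rintro _ ⟨m, rfl⟩
      refine DFunLike.ext _ _ fun r => ?_
      exact (QuotientAddGroup.eq_zero_iff _).2 ⟨M.act S T m r, f.app_act m r⟩))
    (fun S a => by
      induction a using QuotientAddGroup.induction_on with | _ a
      exact congrArg QuotientAddGroup.mk (map_id_apply S a))
    (fun x y a => by
      induction a using QuotientAddGroup.induction_on with | _ a
      exact congrArg QuotientAddGroup.mk (map_comp_apply x y a))
    (fun x y a => by
      induction a using QuotientAddGroup.induction_on with | _ a
      exact congrArg QuotientAddGroup.mk (map_add_apply x y a))
    (fun x y m r => by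
      induction m using QuotientAddGroup.induction_on with | _ m
      exact congrArg QuotientAddGroup.mk (N.act_natural x y m r))
    (fun m => by
      induction m using QuotientAddGroup.induction_on with | _ m
      exact congrArg QuotientAddGroup.mk (N.act_one m))
    (fun m r r' => by
      induction m using QuotientAddGroup.induction_on with | _ m
      exact congrArg QuotientAddGroup.mk (N.act_assoc m r r'))

/-- The projection to the cokernel. -/
def cokerπ (f : M ⟶ N) : N ⟶ coker f :=
  homMk (fun S => QuotientAddGroup.mk' (f.app.app S).hom.range) (fun _ _ => rfl) fun _ _ => rfl

theorem comp_cokerπ (f : M ⟶ N) : f ≫ cokerπ f = 0 :=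
  hom_ext fun _ m => (QuotientAddGroup.eq_zero_iff _).2 ⟨m, rfl⟩

/-- The factorization through the cokernel. -/
def cokerDesc (f : M ⟶ N) (k : N ⟶ P) (h : f ≫ k = 0) : coker f ⟶ P :=
  homMk (fun S => QuotientAddGroup.lift (f.app.app S).hom.range (k.app.app S).hom (by
      rintro _ ⟨m, rfl⟩
      change (f ≫ k).app.app S m = 0
      rw [h]
      rfl))
    (fun x m => by
      induction m using QuotientAddGroup.induction_on with | _ m
      exact naturality_apply k x m)
    (fun m r => by
      induction m using QuotientAddGroup.induction_on with | _ m
      exact k.app_act m r)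

instance : HasCokernels (MackeyModule R) where
  has_colimit f := HasColimit.mk ⟨CokernelCofork.ofπ (cokerπ f) (comp_cokerπ f),
    CokernelCofork.IsColimit.ofπ _ _ (fun k hk => cokerDesc f k hk) (fun _ _ => rfl)
      (fun k hk m hm => hom_ext fun S p => by
        subst hm
        induction p using QuotientAddGroup.induction_on with | _ p
        rfl)⟩

theorem injective_of_mono (f : M ⟶ N) [Mono f] (S : Burnside G) :
    Function.Injective (f.app.app S) := by
  refine (injective_iff_map_eq_zero (f.app.app S).hom).2 fun m hm => ?_
  have h : kerι f = 0 := (cancel_mono f).1 ((kerι_comp f).trans zero_comp.symm)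
  exact congrArg (fun k : ker f ⟶ M => k.app.app S ⟨m, hm⟩) h

theorem surjective_of_epi (f : M ⟶ N) [Epi f] (S : Burnside G) :
    Function.Surjective (f.app.app S) := fun n => by
  have h : cokerπ f = 0 := (cancel_epi f).1 ((comp_cokerπ f).trans comp_zero.symm)
  exact (QuotientAddGroup.eq_zero_iff n).1
    (congrArg (fun k : N ⟶ coker f => k.app.app S n) h)

/-- The factorization of a morphism through an objectwise injective one. -/
def monoLift (f : M ⟶ N) (hf : ∀ S, Function.Injective (f.app.app S)) (k : P ⟶ N)
    (h : k ≫ cokerπ f = 0) : P ⟶ M :=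
  have key (S : Burnside G) (p : P.functor.obj S) : ∃ m, f.app.app S m = k.app.app S p :=
    (QuotientAddGroup.eq_zero_iff _).1
      (congrArg (fun k : P ⟶ coker f => k.app.app S p) h)
  homMk (fun S =>
      { toFun := fun p => (key S p).choose
        map_zero' := hf S (by rw [(key S 0).choose_spec, map_zero, map_zero])
        map_add' := fun p q => hf S (by
          rw [(key S _).choose_spec, map_add, map_add, (key S p).choose_spec,
            (key S q).choose_spec]) })
    (fun {S T} x m => hf T (by
      rw [naturality_apply]
      exact (key T _).choose_spec.trans ((naturality_apply k x m).trans
        (congrArg (N.functor.map x) (key S m).choose_spec.symm))))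
    (fun {S T} m r => hf _ (by
      rw [f.app_act]
      exact (key _ _).choose_spec.trans ((k.app_act m r).trans
        (congrArg (fun n => N.act S T n r) (key S m).choose_spec.symm))))

theorem monoLift_comp (f : M ⟶ N) (hf : ∀ S, Function.Injective (f.app.app S)) (k : P ⟶ N)
    (h : k ≫ cokerπ f = 0) : monoLift f hf k h ≫ f = k :=
  hom_ext fun S p => Exists.choose_spec (p := fun m => f.app.app S m = k.app.app S p) _

/-- The factorization of a morphism through an objectwise surjective one. -/
def epiDesc (f : M ⟶ N) (hf : ∀ S, Function.Surjective (f.app.app S)) (k : M ⟶ P)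
    (h : kerι f ≫ k = 0) : N ⟶ P :=
  have key (S : Burnside G) (m m' : M.functor.obj S) (e : f.app.app S m = f.app.app S m') :
      k.app.app S m = k.app.app S m' := by
    rw [← sub_eq_zero, ← map_sub]
    exact congrArg (fun k : ker f ⟶ P => k.app.app S ⟨m - m', by
      change f.app.app S (m - m') = 0
      rw [map_sub, e, sub_self]⟩) h
  have sp (S : Burnside G) (n : N.functor.obj S) : f.app.app S (hf S n).choose = n :=
    (hf S n).choose_spec
  homMk (fun S =>
      { toFun := fun n => k.app.app S (hf S n).choose
        map_zero' := by
          rw [← map_zero (k.app.app S).hom]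
          exact key S _ _ (by rw [sp]; exact (map_zero (f.app.app S).hom).symm)
        map_add' := fun n n' => by
          rw [← map_add]
          exact key S _ _ (by rw [sp, map_add, sp, sp]) })
    (fun {S T} x n => by
      refine Eq.trans (key T _ (M.functor.map x (hf S n).choose) ?_) (naturality_apply k x _)
      rw [sp, naturality_apply, sp])
    (fun {S T} n r => by
      refine Eq.trans (key _ _ (M.act S T (hf S n).choose r) ?_) (k.app_act _ r)
      rw [sp, f.app_act, sp])

theorem comp_epiDesc (f : M ⟶ N) (hf : ∀ S, Function.Surjective (f.app.app S)) (k : M ⟶ P)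
    (h : kerι f ≫ k = 0) : f ≫ epiDesc f hf k h = k :=
  hom_ext fun S m => by
    have e : f.app.app S (hf S (f.app.app S m)).choose = f.app.app S m :=
      (hf S (f.app.app S m)).choose_spec
    change k.app.app S (hf S (f.app.app S m)).choose = k.app.app S m
    rw [← sub_eq_zero, ← map_sub]
    exact congrArg (fun k : ker f ⟶ P => k.app.app S ⟨_ - m, by
      change f.app.app S (_ - m) = 0
      rw [map_sub, e, sub_self]⟩) h

instance : IsNormalMonoCategory (MackeyModule R) where
  normalMonoOfMono f _ := ⟨
    { Z := coker f
      g := cokerπ f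
      w := comp_cokerπ f
      isLimit := KernelFork.IsLimit.ofι _ _
        (fun k hk => monoLift f (injective_of_mono f) k hk)
        (fun k hk => monoLift_comp f (injective_of_mono f) k hk)
        (fun _ _ _ hm => (cancel_mono f).1 (hm.trans (monoLift_comp _ _ _ _).symm)) }⟩

instance : IsNormalEpiCategory (MackeyModule R) where
  normalEpiOfEpi f _ := ⟨
    { W := ker f
      g := kerι f
      w := kerι_comp f
      isColimit := CokernelCofork.IsColimit.ofπ _ _
        (fun k hk => epiDesc f (surjective_of_epi f) k hk)
        (fun k hk => comp_epiDesc f (surjective_of_epi f) k hk)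
        (fun _ _ _ hm => (cancel_epi f).1 (hm.trans (comp_epiDesc _ _ _ _).symm)) }⟩

instance : Abelian (MackeyModule R) where

end MackeyModule

/-- The abelian category of modules over the constant Green functor `ℤ`. -/
abbrev ZMackeyModule (G : Type u) [Group G] := MackeyModule (constantGreen G)

/-- The action of `G` on the abelian group underlying a `ℤ[G]`-module. -/
def repAction (V : Rep.{u} ℤ G) : G →* AddMonoid.End V where
  toFun g := (V.ρ g).toAddMonoidHom
  map_one' := by
    rw [map_one]
    rfl
  map_mul' g h := by
    rw [map_mul]
    rfl

/-- The fixed point Mackey functor `G/H ↦ V^H` of a `ℤ[G]`-module `V`, with the action of the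
constant Green functor by multiplication with integers. -/
def fixedPointModule (V : Rep.{u} ℤ G) : ZMackeyModule G where
  functor := fixedPointFunctor (repAction V)
  act := fun S T => pairing (repAction V) S T
  act_natural := fun x y m r => pairing_natural (repAction V) x y m r
  act_one := fun m => pairing_one (repAction V) m
  act_assoc := fun m r r' => pairing_assoc (repAction V) m r r'

/-- Postcomposition of equivariant maps with a morphism of `ℤ[G]`-modules. -/
def postcomp {V W : Rep.{u} ℤ G} (φ : V ⟶ W) (S : Burnside G) :
    equivariantMaps (repAction V) S →+ equivariantMaps (repAction W) S where
  toFun f := ⟨fun s => φ.hom (f.1 s), fun g s => by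
    beta_reduce
    rw [f.2]
    exact Rep.hom_comm_apply φ g (f.1 s)⟩
  map_zero' := Subtype.ext (funext fun _ => map_zero φ.hom)
  map_add' f f' := Subtype.ext (funext fun s => map_add φ.hom (f.1 s) (f'.1 s))

theorem postcomp_homMap {V W : Rep.{u} ℤ G} (φ : V ⟶ W) {S T : Burnside G}
    (x : Burnside.Hom S T) (f : equivariantMaps (repAction V) S) :
    postcomp φ T (homMap (repAction V) S T x f) = homMap (repAction W) S T x (postcomp φ S f) := by
  induction x using Burnside.Hom.ind with
  | hof A =>
    rw [homMap_of, homMap_of]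
    refine Subtype.ext (funext fun t => ?_)
    exact map_finsum φ.hom
      (f := fun a : {a : A.apex // A.right a = t} => f.1 (A.left a)) (Set.toFinite _)
  | hsub x y hx hy => simp only [map_sub, AddMonoidHom.sub_apply, hx, hy]

/-- The functor sending a `ℤ[G]`-module to its fixed point Mackey functor. -/
def fixedPoints (G : Type u) [Group G] : Rep.{u} ℤ G ⥤ ZMackeyModule G where
  obj V := fixedPointModule V
  map {V W} φ := MackeyModule.homMk (M := fixedPointModule V) (N := fixedPointModule W)
    (postcomp φ) (fun x m => postcomp_homMap φ x m)
    (fun m r => Subtype.ext (funext fun p => map_zsmul φ.hom (r.1 p.2) (m.1 p.1)))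
  map_id _ := rfl
  map_comp _ _ := rfl

instance (G : Type u) [Group G] : (fixedPoints G).Additive where
  map_add := MackeyModule.hom_ext fun _ _ => rfl

/-- The `H`-fixed points functor from `ℤ[G]`-modules to abelian groups. -/
abbrev subgroupFixedPoints (H : Subgroup G) : Rep.{u} ℤ G ⥤ ModuleCat.{u} ℤ :=
  Rep.resFunctor H.subtype ⋙ Rep.invariantsFunctor ℤ H

/-- The fp-equivalences: the chain maps of complexes of `ℤ[G]`-modules which induce
quasi-isomorphisms on `H`-fixed points for every subgroup `H` of `G`. -/
def fpEquivalences (G : Type u) [Group G] : MorphismProperty (ChainComplex (Rep.{u} ℤ G) ℤ) :=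
  fun _ _ f => ∀ H : Subgroup G,
    QuasiIso (((subgroupFixedPoints H).mapHomologicalComplex (ComplexShape.down ℤ)).map f)

/-- The derived category of complexes of `ℤ[G]`-modules with respect to fp-equivalences. -/
abbrev DerivedFP (G : Type u) [Group G] := (fpEquivalences G).Localization

/-- The functor sending a chain complex `C` of `ℤ[G]`-modules to the complex `G/H ↦ C^H` of Mackey
modules, viewed in the derived category. Chain complexes are regarded as cochain complexes
through `n ↦ -n`. -/
def fixedPointsDerived (G : Type u) [Group G] [HasDerivedCategory.{w} (ZMackeyModule G)] :
    ChainComplex (Rep.{u} ℤ G) ℤ ⥤ DerivedCategory (ZMackeyModule G) :=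
  (fixedPoints G).mapHomologicalComplex (ComplexShape.down ℤ) ⋙
    (ChainComplex.cochainComplexEquivalence (ZMackeyModule G)).functor ⋙ DerivedCategory.Q

end Modules

end

end MackeyChains

open MackeyChains

/-!
The functor `F = fixedPoints G` from `ℤ[G]`-modules to `ℤ`-Mackey modules is a fully faithful
right adjoint: its left adjoint `L` evaluates a Mackey module at the free orbit `G/e`, one has
`F ⋙ L ≅ 𝟭`, and the unit `M(S) → Map_G(S, M(G/e))` restricts along all maps `G/e → S`. Call `M` a
*fixed point module* if this unit is an isomorphism at `M`.

* Fixed point modules are closed under kernels (`IsFixedPoint.of_exact`) and under direct sums, and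
  the free modules `T ↦ ℤ(S × T)` are fixed point modules. Every Mackey module `M` is functorially
  a quotient of a direct sum of free modules (`coverFunctor`), with one summand for each *nonzero*
  element of `M`, so that the functor preserves zero morphisms and applies to complexes.
* Covering a complex and then the kernel of the cover leaves a second syzygy, which is the kernel
  of a morphism between fixed point modules, hence a fixed point module. Two nested mapping cones
  thus replace every complex `X`, unbounded or not, functorially by a quasi-isomorphic complex
  `T(X)` of fixed point modules (`quasiIso_coneDesc_resolvedSyzygy`).
* Consequently `X ↦ L(T(X))` is inverse to `F` up to the quasi-isomorphisms of complexes of Mackey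
  modules and the morphisms which `F` sends to quasi-isomorphisms, and `F` induces an equivalence of
  the localizations (`exists_equivalence_derivedCategory`).
* The identity of a finite `G`-set `S` is the sum of the transfers of the restrictions to its orbits
  (`id_eq_finsum_orbits`), so quasi-isomorphisms of complexes of Mackey modules are detected on the
  orbits `G/H`. As `F(V)(G/H) = V^H`, the morphisms which `F` sends to quasi-isomorphisms are
  exactly the fp-equivalences (`fpEquivalences_iff`).
-/

/-! ### Restrictions and coproducts of spans -/

namespace MackeyChains

noncomputable section

namespace Burnside

variable {G : Type u} [Group G] {S T U S' T' : Burnside G}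

theorem Hom.of_eq_of_equiv {A B : Span S T} (e : A.apex ≃ B.apex)
    (h : ∀ (g : G) x, e (g • x) = g • e x)
    (hl : ∀ x, B.left (e x) = A.left x) (hr : ∀ x, B.right (e x) = A.right x) :
    Hom.of A = Hom.of B :=
  congrArg Algebra.GrothendieckAddGroup.of (SpanClass.sound e h hl hr)

/-- The contravariant functoriality of the Burnside category in equivariant maps. -/
def res (f : S →[G] T) : T ⟶ S := Hom.of ⟨S, f, MulActionHom.id G⟩

theorem of_comp_of (A : Span S T) (B : Span T U) :
    (show S ⟶ T from Hom.of A) ≫ (show T ⟶ U from Hom.of B) = Hom.of (A.comp B) :=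
  Hom.comp_of A B

/-- The coproduct of a finite family of diagrams, in the apex. -/
def Span.sigma {ι : Type u} [Finite ι] (A : ι → Span S T) : Span S T where
  apex := ⟨Σ i, (A i).apex⟩
  left := ⟨fun x => (A x.1).left x.2, fun g x => map_smul (A x.1).left g x.2⟩
  right := ⟨fun x => (A x.1).right x.2, fun g x => map_smul (A x.1).right g x.2⟩

theorem Hom.of_sigma {ι : Type u} [Finite ι] (A : ι → Span S T) :
    Hom.of (Span.sigma A) = ∑ᶠ i, Hom.of (A i) := by
  suffices H : ∀ (ι : Type u) [Finite ι] (A : ι → Span S T),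
      Hom.of (Span.sigma A) = ∑ᶠ i, Hom.of (A i) from H ι A
  intro ι hι A
  refine Finite.induction_empty_option (P := fun ι => ∀ [Finite ι] (A : ι → Span S T),
    Hom.of (Span.sigma A) = ∑ᶠ i, Hom.of (A i)) ?_ ?_ ?_ ι A
  · intro α β e ih _ A
    have := Finite.of_equiv _ e.symm
    rw [← finsum_comp_equiv e, ← ih]
    exact (Hom.of_eq_of_equiv (A := Span.sigma fun a => A (e a)) (B := Span.sigma A)
      (Equiv.sigmaCongrLeft (β := fun b => (A b).apex) e)
      (fun _ _ => rfl) (fun _ => rfl) (fun _ => rfl)).symm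
  · intro _ A
    rw [finsum_of_isEmpty]
    refine Eq.trans (Hom.of_eq_of_equiv (B := Span.empty S T)
      (Equiv.equivOfIsEmpty (α := Σ i, (A i).apex) (β := PEmpty))
      (fun _ x => x.1.elim) (fun x => x.1.elim) (fun x => x.1.elim)) ?_
    exact map_zero (Algebra.GrothendieckAddGroup.of (M := SpanClass S T))
  · intro α _ ih _ A
    have : ∑ᶠ i, Hom.of (A i) = Hom.of (A none) + ∑ᶠ i, Hom.of (A (some i)) := by
      cases nonempty_fintype α
      rw [finsum_eq_sum_of_fintype, finsum_eq_sum_of_fintype, Fintype.sum_option]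
    rw [this, ← ih]
    refine Eq.trans (Hom.of_eq_of_equiv (B := (A none).sum (Span.sigma fun i => A (some i)))
      { toFun := fun x => match x with
          | ⟨none, a⟩ => Sum.inl a
          | ⟨some i, a⟩ => Sum.inr ⟨i, a⟩
        invFun := fun x => match x with
          | Sum.inl a => ⟨none, a⟩
          | Sum.inr ⟨i, a⟩ => ⟨some i, a⟩
        left_inv := by rintro ⟨_ | i, a⟩ <;> rfl
        right_inv := by rintro (a | ⟨i, a⟩) <;> rfl } ?_ ?_ ?_)
      (map_add (Algebra.GrothendieckAddGroup.of (M := SpanClass S T)) (.mk _) (.mk _))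
    · rintro g ⟨_ | i, a⟩ <;> rfl
    · rintro ⟨_ | i, a⟩ <;> rfl
    · rintro ⟨_ | i, a⟩ <;> rfl

end Burnside
end
end MackeyChains

/-! ### Length-two resolutions of complexes from functorial covers -/

namespace MackeyChains

noncomputable section

section Resolution

open Limits CochainComplex

variable {C : Type u} [Category.{v} C] [Abelian C]

open Pretriangulated in
theorem quasiIso_mappingCone_map {K₁ L₁ K₂ L₂ : CochainComplex C ℤ} (φ₁ : K₁ ⟶ L₁)
    (φ₂ : K₂ ⟶ L₂) (a : K₁ ⟶ K₂) (b : L₁ ⟶ L₂) (comm : φ₁ ≫ b = a ≫ φ₂)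
    [QuasiIso a] [QuasiIso b] : QuasiIso (mappingCone.map φ₁ φ₂ a b comm) := by
  let _ := HasDerivedCategory.standard C
  rw [← DerivedCategory.isIso_Q_map_iff_quasiIso]
  exact isIso₃_of_isIso₁₂
    (DerivedCategory.Q.mapTriangle.map (mappingCone.triangleMap φ₁ φ₂ a b comm))
    (DerivedCategory.mappingCone_triangle_distinguished φ₁)
    (DerivedCategory.mappingCone_triangle_distinguished φ₂)
    (inferInstanceAs (IsIso (DerivedCategory.Q.map a)))
    (inferInstanceAs (IsIso (DerivedCategory.Q.map b)))

/-- The first term of a short exact sequence may be replaced by a quasi-isomorphic complex without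
changing the quasi-isomorphism type of the cone. -/
theorem quasiIso_descShortComplex_of_quasiIso {S S' : ShortComplex (CochainComplex C ℤ)}
    (hS : S.ShortExact) (f : S' ⟶ S) [QuasiIso f.τ₁] [QuasiIso f.τ₂] [IsIso f.τ₃] :
    QuasiIso (mappingCone.descShortComplex S') := by
  have := mappingCone.quasiIso_descShortComplex hS
  have := quasiIso_mappingCone_map S'.f S.f f.τ₁ f.τ₂ f.comm₁₂.symm
  have h := mappingCone.map_descShortComplex S' S f
  have : QuasiIso (mappingCone.descShortComplex S' ≫ f.τ₃) := by
    rw [← h]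
    infer_instance
  exact quasiIso_of_comp_right (mappingCone.descShortComplex S') f.τ₃

/-- The mapping cone of a natural transformation between functors to complexes, given as the first
morphism of a short complex. -/
def coneFunctor {D : Type*} [Category* D] (S : ShortComplex (D ⥤ CochainComplex C ℤ)) :
    D ⥤ CochainComplex C ℤ where
  obj X := mappingCone (S.f.app X)
  map h := mappingCone.map _ _ (S.X₁.map h) (S.X₂.map h) (S.f.naturality h).symm
  map_id X := by
    refine Eq.trans ?_ (mappingCone.map_id _)
    congr 1
    exacts [S.X₁.map_id X, S.X₂.map_id X]
  map_comp f g := by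
    refine Eq.trans ?_ (mappingCone.map_comp _ _ _ _ _ (S.f.naturality f).symm _ _
      (S.f.naturality g).symm)
    congr 1
    exacts [S.X₁.map_comp f g, S.X₂.map_comp f g]

/-- The natural transformation from the cone of the first morphism to the third term of a short
complex. -/
def coneDesc {D : Type*} [Category* D] (S : ShortComplex (D ⥤ CochainComplex C ℤ)) :
    coneFunctor S ⟶ S.X₃ where
  app X := mappingCone.descShortComplex (S.map ((evaluation _ _).obj X))
  naturality X Y h := mappingCone.map_descShortComplex (S.map ((evaluation _ _).obj X))
    (S.map ((evaluation _ _).obj Y))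
    { τ₁ := S.X₁.map h, τ₂ := S.X₂.map h, τ₃ := S.X₃.map h
      comm₁₂ := S.f.naturality h, comm₂₃ := S.g.naturality h }

variable (Q : C ⥤ C) [Q.PreservesZeroMorphisms] (π : Q ⟶ 𝟭 C)

/-- A natural transformation `Q ⟶ 𝟭 C`, applied in every degree of a complex. -/
def coverMap : Q.mapHomologicalComplex (ComplexShape.up ℤ) ⟶ 𝟭 (CochainComplex C ℤ) where
  app X := { f := fun i => π.app (X.X i), comm' := fun i j _ => (π.naturality (X.d i j)).symm }
  naturality X Y f := by
    ext i
    exact π.naturality (f.f i)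

/-- The short complex `K ⟶ Q(X) ⟶ X`, where `K` is the kernel of `Q(X) ⟶ X`. -/
def syzygy : ShortComplex (CochainComplex C ℤ ⥤ CochainComplex C ℤ) :=
  ShortComplex.mk (kernel.ι (coverMap Q π)) (coverMap Q π) (kernel.condition _)

/-- The short complex `R(K) ⟶ Q(X) ⟶ X`, where `K` is the kernel of `Q(X) ⟶ X` and `R(K)` the cone
of `K' ⟶ Q(K)`, with `K'` the kernel of `Q(K) ⟶ K`. -/
def resolvedSyzygy : ShortComplex (CochainComplex C ℤ ⥤ CochainComplex C ℤ) :=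
  ShortComplex.mk (X₁ := (syzygy Q π).X₁ ⋙ coneFunctor (syzygy Q π))
    (Functor.whiskerLeft (syzygy Q π).X₁ (coneDesc (syzygy Q π)) ≫ (syzygy Q π).f)
    (syzygy Q π).g ((Category.assoc _ _ _).trans
      ((congrArg (_ ≫ ·) (syzygy Q π).zero).trans comp_zero))

variable [∀ X, Epi (π.app X)]

theorem syzygy_shortExact (X : CochainComplex C ℤ) :
    ((syzygy Q π).map ((evaluation _ _).obj X)).ShortExact := by
  have (X : CochainComplex C ℤ) : Epi ((coverMap Q π).app X) :=
    have (i : ℤ) : Epi (((coverMap Q π).app X).f i) := inferInstanceAs (Epi (π.app _))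
    HomologicalComplex.epi_of_epi_f _ inferInstance
  have : Epi (coverMap Q π) := NatTrans.epi_of_epi_app _
  have : Epi (syzygy Q π).g := this
  have : Mono (syzygy Q π).f := equalizer.ι_mono
  have h : (syzygy Q π).ShortExact := { exact := ShortComplex.exact_kernel _ }
  exact h.map_of_exact _

/-- The cone of `R(K) ⟶ Q(X)` is quasi-isomorphic to the cone of `K ⟶ Q(X)`, hence to `X`. -/
theorem quasiIso_coneDesc_resolvedSyzygy (X : CochainComplex C ℤ) :
    QuasiIso ((coneDesc (resolvedSyzygy Q π)).app X) := by
  have : QuasiIso ((coneDesc (syzygy Q π)).app ((syzygy Q π).X₁.obj X)) :=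
    mappingCone.quasiIso_descShortComplex (syzygy_shortExact Q π _)
  let f : (resolvedSyzygy Q π).map ((evaluation _ _).obj X) ⟶
      (syzygy Q π).map ((evaluation _ _).obj X) :=
    { τ₁ := (coneDesc (syzygy Q π)).app ((syzygy Q π).X₁.obj X)
      τ₂ := 𝟙 _
      τ₃ := 𝟙 _
      comm₁₂ := (Category.comp_id _).symm
      comm₂₃ := (Category.id_comp _).trans (Category.comp_id _).symm }
  have : QuasiIso f.τ₁ := this
  have : QuasiIso f.τ₂ := inferInstanceAs (QuasiIso (𝟙 _))
  have : IsIso f.τ₃ := inferInstanceAs (IsIso (𝟙 _))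
  exact quasiIso_descShortComplex_of_quasiIso (syzygy_shortExact Q π X) f

variable (P : ObjectProperty C) [P.IsClosedUnderIsomorphisms]

theorem prop_mappingCone_X (biprod : ∀ X Y, P X → P Y → P (X ⊞ Y)) {K L : CochainComplex C ℤ}
    (φ : K ⟶ L) (hK : ∀ i, P (K.X i)) (hL : ∀ i, P (L.X i)) (i : ℤ) :
    P ((mappingCone φ).X i) :=
  P.prop_of_iso (HomologicalComplex.homotopyCofiber.XIsoBiprod φ i (i + 1) rfl).symm
    (biprod _ _ (hK _) (hL _))

/-- A class of objects which is closed under kernels and contains the values of `Q` contains the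
second syzygies: the kernel of `Q(K) ⟶ K`, where `K` is the kernel of `Q(X) ⟶ X`, is also the kernel
of the composite `Q(K) ⟶ K ⟶ Q(X)`. -/
theorem prop_coneFunctor_resolvedSyzygy (biprod : ∀ X Y, P X → P Y → P (X ⊞ Y))
    (ker : ∀ S : ShortComplex C, S.Exact → Mono S.f → P S.X₂ → P S.X₃ → P S.X₁)
    (hQ : ∀ X, P (Q.obj X)) (X : CochainComplex C ℤ) (i : ℤ) :
    P (((coneFunctor (resolvedSyzygy Q π)).obj X).X i) := by
  refine prop_mappingCone_X P biprod _ (prop_mappingCone_X P biprod _ (fun j => ?_) fun j => hQ _)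
    (fun j => hQ _) i
  have h := (syzygy_shortExact Q π X).map_of_exact (HomologicalComplex.eval C _ j)
  have h' := (syzygy_shortExact Q π ((syzygy Q π).X₁.obj X)).map_of_exact
    (HomologicalComplex.eval C _ j)
  have := h.mono_f
  let S := ShortComplex.mk _ _ ((Category.assoc _ _ _).symm.trans
    ((congrArg (· ≫ (((syzygy Q π).f.app X).f j)) (ShortComplex.zero (((syzygy Q π).map
      ((evaluation _ _).obj ((syzygy Q π).X₁.obj X))).map (HomologicalComplex.eval C _ j)))).trans
        zero_comp))
  refine ker S ?_ h'.mono_f (hQ _) (hQ _)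
  let f : ((syzygy Q π).map ((evaluation _ _).obj ((syzygy Q π).X₁.obj X))).map
      (HomologicalComplex.eval C _ j) ⟶ S :=
    { τ₁ := 𝟙 _
      τ₂ := 𝟙 _
      τ₃ := ((syzygy Q π).f.app X).f j
      comm₁₂ := (Category.id_comp _).trans (Category.comp_id _).symm
      comm₂₃ := Category.id_comp _ }
  have : Epi f.τ₁ := inferInstanceAs (Epi (𝟙 _))
  have : IsIso f.τ₂ := inferInstanceAs (IsIso (𝟙 _))
  have : Mono f.τ₃ := ‹_›
  exact (ShortComplex.exact_iff_of_epi_of_isIso_of_mono f).1 h'.exact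

end Resolution

end
end MackeyChains

/-! ### Inverting quasi-isomorphisms after a fully faithful embedding -/

namespace MackeyChains

noncomputable section

section Localization

open Limits

variable {A : Type*} [Category* A] [Preadditive A] {B : Type*} [Category* B] [Abelian B]
  (F : A ⥤ B) [F.Additive] (L : B ⥤ A) [L.Additive] (η : 𝟭 B ⟶ L ⋙ F)

/-- The natural transformation `η : 𝟭 B ⟶ L ⋙ F`, applied in every degree of a complex. -/
def unitMap : 𝟭 (CochainComplex B ℤ) ⟶
    L.mapHomologicalComplex (ComplexShape.up ℤ) ⋙ F.mapHomologicalComplex (ComplexShape.up ℤ) where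
  app X := { f := fun i => η.app (X.X i), comm' := fun i j _ => (η.naturality (X.d i j)).symm }
  naturality X Y f := by
    ext i
    exact η.naturality (f.f i)

/-- The natural transformation `ε : F ⋙ L ≅ 𝟭 A`, applied in every degree of a complex. -/
def counitMap (ε : F ⋙ L ≅ 𝟭 A) : F.mapHomologicalComplex (ComplexShape.up ℤ) ⋙
    L.mapHomologicalComplex (ComplexShape.up ℤ) ⟶ 𝟭 (CochainComplex A ℤ) where
  app X := { f := fun i => ε.hom.app (X.X i)
             comm' := fun i j _ => (ε.hom.naturality (X.d i j)).symm }
  naturality X Y f := by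
    ext i
    exact ε.hom.naturality (f.f i)

theorem isIso_unitMap_app (X : CochainComplex B ℤ) (h : ∀ i, IsIso (η.app (X.X i))) :
    IsIso ((unitMap F L η).app X) :=
  have (i : ℤ) : IsIso (((unitMap F L η).app X).f i) := h i
  HomologicalComplex.Hom.isIso_of_components _

instance (ε : F ⋙ L ≅ 𝟭 A) (Y : CochainComplex A ℤ) : IsIso ((counitMap F L ε).app Y) :=
  have (i : ℤ) : IsIso (((counitMap F L ε).app Y).f i) := inferInstanceAs (IsIso (ε.hom.app _))
  HomologicalComplex.Hom.isIso_of_components _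

theorem isIso_app_biprod (X Y : B) (hX : IsIso (η.app X)) (hY : IsIso (η.app Y)) :
    IsIso (η.app (X ⊞ Y)) := by
  let S := ShortComplex.mk (biprod.inl : X ⟶ X ⊞ Y) biprod.snd (by simp)
  let s : S.Splitting := { r := biprod.fst, s := biprod.inr }
  let φ : S ⟶ S.map (L ⋙ F) :=
    { τ₁ := η.app X, τ₂ := η.app (X ⊞ Y), τ₃ := η.app Y
      comm₁₂ := (η.naturality _).symm, comm₂₃ := (η.naturality _).symm }
  have : IsIso φ.τ₁ := hX
  have : IsIso φ.τ₃ := hY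
  exact ShortComplex.isIso₂_of_shortExact_of_isIso₁₃ φ s.shortExact (s.map (L ⋙ F)).shortExact

theorem quasiIso_of_natTrans {D : Type*} [Category* D] {S T : D ⥤ CochainComplex B ℤ} (τ : S ⟶ T)
    {X Y : D} (f : X ⟶ Y) [QuasiIso (τ.app X)] [QuasiIso (τ.app Y)] :
    QuasiIso (S.map f) ↔ QuasiIso (T.map f) := by
  rw [← quasiIso_iff_comp_right (S.map f) (τ.app Y), τ.naturality,
    quasiIso_iff_comp_left (τ.app X)]

/-- The abstract form of the equivalence. Let `F` be an additive functor to an abelian category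
which has an additive left inverse `L` with a natural transformation `η : 𝟭 ⟶ L ⋙ F`. The objects at
which `η` is an isomorphism are assumed to be closed under kernels and to contain the values of `F`
and of a functor `Q` with a natural epimorphism to the identity. Then the localization of the
complexes in `A` at the morphisms inverted by `F` is the derived category of `B`. The inverse
equivalence applies `L` to a functorial resolution by objects at which `η` is an isomorphism. -/
theorem exists_equivalence_derivedCategory [HasDerivedCategory B] (ε : F ⋙ L ≅ 𝟭 A)
    (hF : ∀ V, IsIso (η.app (F.obj V)))
    (ker : ∀ S : ShortComplex B, S.Exact → Mono S.f → IsIso (η.app S.X₂) → IsIso (η.app S.X₃) →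
      IsIso (η.app S.X₁))
    (Q : B ⥤ B) [Q.PreservesZeroMorphisms] (π : Q ⟶ 𝟭 B) [∀ M, Epi (π.app M)]
    (hQ : ∀ M, IsIso (η.app (Q.obj M))) {D : Type*} [Category* D] (L₁ : CochainComplex A ℤ ⥤ D)
    [L₁.IsLocalization ((HomologicalComplex.quasiIso B (ComplexShape.up ℤ)).inverseImage
      (F.mapHomologicalComplex (ComplexShape.up ℤ)))] :
    ∃ e : D ≌ DerivedCategory B, Nonempty
      (L₁ ⋙ e.functor ≅ F.mapHomologicalComplex (ComplexShape.up ℤ) ⋙ DerivedCategory.Q) := by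
  let WB := HomologicalComplex.quasiIso B (ComplexShape.up ℤ)
  let Φ := F.mapHomologicalComplex (ComplexShape.up ℤ)
  let Λ := L.mapHomologicalComplex (ComplexShape.up ℤ)
  let WA := WB.inverseImage Φ
  let T := coneFunctor (resolvedSyzygy Q π)
  let τ : T ⟶ 𝟭 _ := coneDesc (resolvedSyzygy Q π)
  let u := unitMap F L η
  have hτ (X) : QuasiIso (τ.app X) := quasiIso_coneDesc_resolvedSyzygy Q π X
  let P : ObjectProperty B := fun M => IsIso (η.app M)
  have : P.IsClosedUnderIsomorphisms :=
    ⟨fun e h => ((MorphismProperty.isomorphisms B).arrow_mk_iso_iff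
      (Arrow.isoMk e ((L ⋙ F).mapIso e) (η.naturality e.hom))).1 h⟩
  have huT (X) : IsIso (u.app (T.obj X)) := isIso_unitMap_app F L η _ fun i =>
    prop_coneFunctor_resolvedSyzygy Q π P (isIso_app_biprod F L η) ker hQ X i
  have huΦ (Y) : IsIso (u.app (Φ.obj Y)) := isIso_unitMap_app F L η _ fun i => hF _
  let Γ := T ⋙ Λ
  let s : T ⟶ Γ ⋙ Φ := Functor.whiskerLeft T u
  have hs (X) : IsIso (s.app X) := huT X
  have hΓ : WB.IsInvertedBy (Γ ⋙ L₁) := fun X Y f hf => by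
    refine Localization.inverts L₁ WA _ ?_
    change QuasiIso ((Γ ⋙ Φ).map f)
    rw [← quasiIso_of_natTrans s, quasiIso_of_natTrans τ]
    exact hf
  have hΦ : WA.IsInvertedBy (Φ ⋙ DerivedCategory.Q) := fun X Y f hf =>
    Localization.inverts DerivedCategory.Q WB _ hf
  -- On complexes in `A`, the resolution comes with an `F`-quasi-isomorphism `L (T (F Y)) ⟶ Y`.
  let t : Φ ⋙ Γ ⟶ 𝟭 _ := Functor.whiskerLeft Φ (Functor.whiskerRight τ Λ) ≫ counitMap F L ε
  have ht (Y) : WA (t.app Y) := by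
    change QuasiIso (Φ.map (Λ.map (τ.app (Φ.obj Y)) ≫ (counitMap F L ε).app Y))
    rw [Functor.map_comp]
    have : QuasiIso ((Λ ⋙ Φ).map (τ.app (Φ.obj Y))) := by
      have := huT (Φ.obj Y)
      have := huΦ Y
      have h : QuasiIso (u.app ((𝟭 _).obj (Φ.obj Y))) :=
        inferInstanceAs (QuasiIso (u.app (Φ.obj Y)))
      rw [← quasiIso_of_natTrans u]
      exact hτ _
    exact inferInstanceAs (QuasiIso ((Λ ⋙ Φ).map (τ.app (Φ.obj Y)) ≫
      Φ.map ((counitMap F L ε).app Y)))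
  let α₀ : Φ ⋙ Γ ⋙ L₁ ≅ L₁ :=
    have (Y : CochainComplex A ℤ) : IsIso ((Functor.whiskerRight t L₁).app Y) :=
      Localization.inverts L₁ WA _ (ht Y)
    have := NatIso.isIso_of_isIso_app (Functor.whiskerRight t L₁)
    asIso (Functor.whiskerRight t L₁)
  let β₀ : Γ ⋙ Φ ⋙ DerivedCategory.Q ≅ DerivedCategory.Q :=
    have (X : CochainComplex B ℤ) : IsIso ((Functor.whiskerRight s DerivedCategory.Q).app X) :=
      inferInstanceAs (IsIso (DerivedCategory.Q.map (s.app X)))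
    have := NatIso.isIso_of_isIso_app (Functor.whiskerRight s DerivedCategory.Q)
    have (X : CochainComplex B ℤ) : IsIso ((Functor.whiskerRight τ DerivedCategory.Q).app X) :=
      inferInstanceAs (IsIso (DerivedCategory.Q.map (τ.app X)))
    have := NatIso.isIso_of_isIso_app (Functor.whiskerRight τ DerivedCategory.Q)
    (asIso (Functor.whiskerRight s DerivedCategory.Q)).symm ≪≫
      asIso (Functor.whiskerRight τ DerivedCategory.Q)
  let G' := Localization.lift (Φ ⋙ DerivedCategory.Q) hΦ L₁
  let F' := Localization.lift (Γ ⋙ L₁) hΓ DerivedCategory.Q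
  exact ⟨Localization.equivalence L₁ WA DerivedCategory.Q WB (Φ ⋙ DerivedCategory.Q) G' (Γ ⋙ L₁) F'
      (Functor.isoWhiskerLeft Φ (Localization.fac (Γ ⋙ L₁) hΓ DerivedCategory.Q) ≪≫ α₀)
      (Functor.isoWhiskerLeft Γ (Localization.fac (Φ ⋙ DerivedCategory.Q) hΦ L₁) ≪≫ β₀),
    ⟨Localization.fac (Φ ⋙ DerivedCategory.Q) hΦ L₁⟩⟩

end Localization

end
end MackeyChains

/-! ### Restrictions in the Burnside category and in Mackey modules -/

namespace MackeyChains

noncomputable section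

namespace Burnside

variable {G : Type u} [Group G] {S T U S' T' : Burnside G}

theorem res_comp_res (f : S →[G] T) (g : U →[G] S) : res f ≫ res g = res (f.comp g) := by
  refine (of_comp_of _ _).trans (Hom.of_eq_of_equiv
    { toFun := fun p => p.1.2
      invFun := fun x => ⟨(g x, x), rfl⟩
      left_inv := by rintro ⟨⟨s, a⟩, h⟩; exact Subtype.ext (Prod.ext h.symm rfl)
      right_inv := fun _ => rfl } (fun _ _ => rfl) ?_ (fun _ => rfl))
  rintro ⟨⟨s, a⟩, h⟩
  exact congrArg f h.symm

theorem res_id (S : Burnside G) : res (MulActionHom.id G : S →[G] S) = 𝟙 S := rfl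

/-- The cartesian product of morphisms of the Burnside category. -/
def prodMap (x : S ⟶ S') (y : T ⟶ T') : S.prod T ⟶ S'.prod T' :=
  (prodFunctor G).map (Prod.mkHom x y)

theorem prodMap_of (A : Span S T) (B : Span S' T') :
    prodMap (show S ⟶ T from Hom.of A) (show S' ⟶ T' from Hom.of B) = Hom.of (A.prod B) :=
  Hom.prod_of A B

/-- The diagonal map. -/
def diag (S : Burnside G) : S →[G] S.prod S := ⟨fun s => (s, s), fun _ _ => rfl⟩

/-- The map to the point. -/
def toPoint (S : Burnside G) : S →[G] point G := ⟨fun _ => PUnit.unit, fun _ _ => rfl⟩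

/-- The map to a product. -/
def pair (f : U →[G] S) (g : U →[G] T) : U →[G] S.prod T :=
  ⟨fun x => (f x, g x), fun a x => Prod.ext (map_smul f a x) (map_smul g a x)⟩

theorem prodMap_res_comp_res_diag (f : U →[G] S) (g : U →[G] T) :
    prodMap (res f) (res g) ≫ res (diag U) = res (pair f g) := by
  refine (congrArg (· ≫ res (diag U)) (prodMap_of _ _)).trans
    ((of_comp_of _ _).trans (Hom.of_eq_of_equiv
    { toFun := fun p => p.1.2
      invFun := fun x => ⟨((x, x), x), rfl⟩
      left_inv := by rintro ⟨⟨⟨s, t⟩, a⟩, h⟩; cases h; rfl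
      right_inv := fun _ => rfl } (fun _ _ => rfl) ?_ (fun _ => rfl)))
  rintro ⟨⟨⟨s, t⟩, a⟩, h⟩
  cases h
  rfl

theorem prodMap_res_toPoint_comp_res_diag (S : Burnside G) :
    prodMap (𝟙 S) (res (toPoint S)) ≫ res (diag S) =
      graph (rightUnit S) := by
  refine (congrArg (· ≫ res (diag S)) (prodMap_of _ _)).trans
    ((of_comp_of _ _).trans (Hom.of_eq_of_equiv
    { toFun := fun p => (p.1.2, PUnit.unit)
      invFun := fun x => ⟨((x.1, x.1), x.1), rfl⟩
      left_inv := by rintro ⟨⟨⟨s, t⟩, a⟩, h⟩; cases h; rfl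
      right_inv := fun _ => rfl } (fun _ _ => rfl) ?_ (fun _ => rfl)))
  rintro ⟨⟨⟨s, t⟩, a⟩, h⟩
  cases h
  rfl

variable [Finite G]

variable (G) in
/-- The free orbit `G/e`, which is `G` with the action by left multiplication. -/
def regular : Burnside G := ⟨G⟩

/-- Right multiplication. -/
def mulRight (g : G) : regular G →[G] regular G :=
  ⟨fun x : G => x * g, fun h (x : G) => mul_assoc h x g⟩

/-- The equivariant map `G → S` which sends the neutral element to a given element. -/
def orbitMap (s : S) : regular G →[G] S := ⟨fun x : G => x • s, fun h (x : G) => mul_smul h x s⟩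

theorem orbitMap_smul (g : G) (s : S) : orbitMap (g • s) = (orbitMap s).comp (mulRight g) :=
  MulActionHom.ext fun (x : G) => (mul_smul x g s).symm

theorem orbitMap_pair (s : S) (t : T) :
    (orbitMap ((s, t) : S × T) : regular G →[G] S.prod T) = pair (orbitMap s) (orbitMap t) := rfl

/-- The double coset formula for the free orbit: the fibre product of `A → T` and an orbit map
`G → T` is a disjoint union of copies of `G`, one for each point of the fibre of `A → T`. -/
theorem of_comp_res_orbitMap (A : Span S T) (t : T) :
    (show S ⟶ T from Hom.of A) ≫ res (orbitMap t) =
      ∑ᶠ a : {a : A.apex // A.right a = t}, res (orbitMap (A.left a)) := by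
  refine (of_comp_of A ⟨regular G, orbitMap t, MulActionHom.id G⟩).trans
    (Eq.trans (Hom.of_eq_of_equiv ?_ ?_ ?_ ?_)
    (Hom.of_sigma fun a : {a : A.apex // A.right a = t} =>
      ⟨regular G, orbitMap (A.left a), MulActionHom.id G⟩))
  · exact
      { toFun := fun p => ⟨⟨(show G from p.1.2)⁻¹ • p.1.1, by
          rw [map_smul, p.2]
          exact inv_smul_smul (show G from p.1.2) t⟩, p.1.2⟩
        invFun := fun q => ⟨((show G from q.2) • q.1.1, q.2), by
          rw [map_smul, q.1.2]
          rfl⟩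
        left_inv := fun p => Subtype.ext (Prod.ext (smul_inv_smul (show G from p.1.2) p.1.1) rfl)
        right_inv := by
          rintro ⟨⟨a, ha⟩, x⟩
          exact Sigma.ext (Subtype.ext (inv_smul_smul (show G from x) a)) HEq.rfl }
  · rintro g ⟨⟨a, x⟩, h⟩
    refine Sigma.ext (Subtype.ext ?_) HEq.rfl
    change (g * (show G from x))⁻¹ • g • a = (show G from x)⁻¹ • a
    rw [mul_inv_rev, mul_smul, inv_smul_smul]
  · rintro ⟨⟨a, x⟩, h⟩
    change (show G from x) • A.left ((show G from x)⁻¹ • a) = A.left a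
    rw [map_smul, smul_inv_smul]
  · exact fun _ => rfl

end Burnside

open Burnside

variable {G : Type u} [Group G]

theorem homMap_res_apply {V : Type v} [AddCommGroup V] (ρ : G →* AddMonoid.End V)
    {S T : Burnside G} (f : S →[G] T) (x : equivariantMaps ρ T) (s : S) :
    (homMap ρ T S (res f) x).1 s = x.1 (f s) := by
  rw [res, homMap_of]
  exact finsum_unique (fun a : {a : S // a = s} => x.1 (f a.1))

namespace MackeyModule

variable {R : GreenFunctor G} {M N : MackeyModule R}

theorem mono_of_injective (f : M ⟶ N) (hf : ∀ S, Function.Injective (f.app.app S)) : Mono f :=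
  ⟨fun _ _ e => hom_ext fun S m => hf S (congrArg (fun k : _ ⟶ N => k.app.app S m) e)⟩

theorem epi_of_surjective (f : M ⟶ N) (hf : ∀ S, Function.Surjective (f.app.app S)) : Epi f :=
  ⟨fun _ _ e => hom_ext fun S n => by
    obtain ⟨m, rfl⟩ := hf S n
    exact congrArg (fun k : M ⟶ _ => k.app.app S m) e⟩

theorem isIso_iff_bijective (f : M ⟶ N) :
    IsIso f ↔ ∀ S, Function.Bijective (f.app.app S) :=
  ⟨fun _ S => ⟨injective_of_mono f S, surjective_of_epi f S⟩, fun h =>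
    have := mono_of_injective f fun S => (h S).1
    have := epi_of_surjective f fun S => (h S).2
    isIso_of_mono_of_epi f⟩

theorem act_prodMap (M : MackeyModule R) {S S' T T' : Burnside G} (x : S ⟶ S') (y : T ⟶ T')
    (m : M.functor.obj S) (r : R.functor.obj T) :
    M.functor.map (prodMap x y) (M.act S T m r) =
      M.act S' T' (M.functor.map x m) (R.functor.map y r) :=
  M.act_natural x y m r

theorem map_res_diag_act (M : MackeyModule R) {S : Burnside G}
    (m : M.functor.obj S) :
    M.functor.map (res (diag S)) (M.act S S m (R.functor.map (res (toPoint S)) R.one)) = m := by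
  have h := M.act_prodMap (𝟙 S) (res (toPoint S)) m R.one
  rw [map_id_apply] at h
  rw [← h, ← map_comp_apply, prodMap_res_toPoint_comp_res_diag, M.act_one]

theorem map_finsum_apply {S T : Burnside G} {ι : Type*} [Finite ι] (x : ι → (S ⟶ T))
    (m : M.functor.obj S) : M.functor.map (∑ᶠ i, x i) m = ∑ᶠ i, M.functor.map (x i) m :=
  map_finsum (({ toFun := fun x => M.functor.map x m
                 map_zero' := by rw [Functor.map_zero]; rfl
                 map_add' := fun x y => map_add_apply x y m } :
    (S ⟶ T) →+ M.functor.obj T)) (Set.toFinite _)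

end MackeyModule

end
end MackeyChains

/-! ### Fixed point functors and evaluation at the free orbit -/

namespace MackeyChains

noncomputable section
open Burnside
variable {G : Type u} [Group G] [Finite G]

namespace MackeyModule

/-- The representation of `G` on the value of a Mackey module at the free orbit `G/e`. -/
def underlying (M : ZMackeyModule G) : Rep.{u} ℤ G :=
  Rep.of (X := M.functor.obj (regular G))
    { toFun := fun g => (M.functor.map (res (mulRight g))).hom.toIntLinearMap
      map_one' := by
        ext m
        have : (mulRight 1 : regular G →[G] regular G) = MulActionHom.id G :=
          MulActionHom.ext fun x : G => mul_one x
        change M.functor.map (res (mulRight 1)) m = m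
        rw [this, res_id, map_id_apply]
      map_mul' := fun g h => by
        ext m
        have : (mulRight (g * h) : regular G →[G] regular G) =
            (mulRight h).comp (mulRight g) :=
          MulActionHom.ext fun x : G => (mul_assoc x g h).symm
        change M.functor.map (res (mulRight (g * h))) m =
          M.functor.map (res (mulRight g)) (M.functor.map (res (mulRight h)) m)
        rw [this, ← res_comp_res, map_comp_apply] }

end MackeyModule
open MackeyModule

variable (G) in
/-- Evaluation of Mackey modules at the free orbit, as a functor to representations of `G`. -/
def evalRegular : ZMackeyModule G ⥤ Rep.{u} ℤ G where
  obj M := underlying M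
  map {M N} f := Rep.ofHom
    { (f.app.app (regular G)).hom.toIntLinearMap with
      isIntertwining' := fun g => LinearMap.ext fun m => naturality_apply f _ m }

instance : (evalRegular G).Additive where
  map_add := Rep.hom_ext (Representation.IntertwiningMap.ext (LinearMap.ext fun _ => rfl))

/-- An equivariant additive bijection is an isomorphism of representations, for arbitrary
`ℤ`-module structures. -/
def repIsoOfAddEquiv {X Y : Type u} [AddCommGroup X] [AddCommGroup Y] [Module ℤ X] [Module ℤ Y]
    (ρ : Representation ℤ G X) (σ : Representation ℤ G Y) (e : X ≃+ Y)
    (h : ∀ g x, e (ρ g x) = σ g (e x)) : Rep.of ρ ≅ Rep.of σ :=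
  Rep.mkIso (.mk { e with map_smul' := fun n x => map_intCast_smul e ℤ ℤ n x }
    fun g => LinearMap.ext (h g))

/-- Evaluation at the neutral element identifies `Map_G(G, V)` with `V`. -/
def evalOneEquiv (V : Rep.{u} ℤ G) : equivariantMaps (repAction V) (regular G) ≃+ V where
  toFun f := f.1 (1 : G)
  map_add' _ _ := rfl
  invFun v := ⟨fun g : G => V.ρ g v, fun g (h : G) => by
    change V.ρ (g * h) v = V.ρ g (V.ρ h v)
    rw [map_mul]
    rfl⟩
  left_inv f := Subtype.ext (funext fun g : G =>
    (f.2 g (1 : G)).symm.trans (congrArg f.1 (mul_one g)))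
  right_inv v := by
    change V.ρ 1 v = v
    rw [map_one]
    rfl

theorem evalOneEquiv_map_mulRight (V : Rep.{u} ℤ G) (g : G)
    (f : equivariantMaps (repAction V) (regular G)) :
    evalOneEquiv V (homMap (repAction V) _ _ (res (mulRight g)) f) = V.ρ g (evalOneEquiv V f) :=
  (homMap_res_apply (repAction V) (mulRight g) f (1 : G)).trans
    ((congrArg f.1 ((one_mul g).trans (mul_one g).symm)).trans (f.2 g (1 : G)))

variable (G) in
/-- A representation is the value of its fixed point Mackey functor at the free orbit. -/
def fixedPointsCompEvalRegular : fixedPoints G ⋙ evalRegular G ≅ 𝟭 (Rep.{u} ℤ G) :=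
  NatIso.ofComponents (fun V =>
    -- The `ℤ`-module structure of `V` is the one bundled in `V`, not the canonical one.
    @repIsoOfAddEquiv _ _ _ _ _ _ _ V.hV2 (underlying ((fixedPoints G).obj V)).ρ V.ρ
      (evalOneEquiv V) (evalOneEquiv_map_mulRight V)) fun _ => rfl

namespace MackeyModule

variable (M : ZMackeyModule G) {N : ZMackeyModule G}

/-- The map `M(S) → Map_G(S, M(G/e))` which restricts an element along all maps `G/e → S`. -/
def restrict (S : Burnside G) :
    M.functor.obj S →+ equivariantMaps (repAction (underlying M)) S where
  toFun m := ⟨fun s => M.functor.map (res (orbitMap s)) m, fun g s => by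
    change M.functor.map (res (orbitMap (g • s))) m =
      M.functor.map (res (mulRight g)) (M.functor.map (res (orbitMap s)) m)
    rw [orbitMap_smul, ← res_comp_res, map_comp_apply]⟩
  map_zero' := Subtype.ext (funext fun s => map_zero (M.functor.map (res (orbitMap s))).hom)
  map_add' m n := Subtype.ext (funext fun s => map_add (M.functor.map (res (orbitMap s))).hom m n)

theorem restrict_apply (S : Burnside G) (m : M.functor.obj S) (s : S) :
    (M.restrict S m).1 s = M.functor.map (res (orbitMap s)) m := rfl

theorem restrict_map {S T : Burnside G} (x : Burnside.Hom S T) (m : M.functor.obj S) :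
    M.restrict T (M.functor.map (show S ⟶ T from x) m) =
      homMap (repAction (underlying M)) S T x (M.restrict S m) := by
  induction x using Burnside.Hom.ind with
  | hof A =>
    rw [homMap_of]
    refine Subtype.ext (funext fun t => ?_)
    rw [restrict_apply, ← map_comp_apply, of_comp_res_orbitMap, map_finsum_apply]
    rfl
  | hsub x y hx hy =>
    rw [map_sub, AddMonoidHom.sub_apply, ← hx, ← hy, ← map_sub]
    congr 1
    exact congrArg (fun f : M.functor.obj S ⟶ M.functor.obj T => f m)
      (M.functor.map_sub (f := (show S ⟶ T from x)) (g := (show S ⟶ T from y)))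

/-- The Green functor `ℤ` is constant: the restriction of an element of `ℤ(T)` along a map
`G/e → T` is the multiple of the unit by its value. -/
theorem constantGreen_map_res_orbitMap {T : Burnside G} (r : (constantGreen G).functor.obj T)
    (t : T) : (constantGreen G).functor.map (res (orbitMap t)) r =
      (r.1 t : ℤ) • (constantGreen G).functor.map (res (toPoint (regular G)))
        (constantGreen G).one :=
  Subtype.ext (funext fun x : G => by
    refine (homMap_res_apply _ (orbitMap t) r x).trans ((r.2 x t).trans ?_)
    refine Eq.trans ?_ (congrArg ((r.1 t : ℤ) • ·) (homMap_res_apply (trivialAction G)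
      (toPoint (regular G)) (constantGreen G).one x).symm)
    exact (mul_one _).symm)

theorem restrict_act {S T : Burnside G} (m : M.functor.obj S)
    (r : (constantGreen G).functor.obj T) :
    M.restrict (S.prod T) (M.act S T m r) =
      pairing (repAction (underlying M)) S T (M.restrict S m) r := by
  refine Subtype.ext (funext fun ⟨s, t⟩ => ?_)
  change M.functor.map (res (orbitMap ((s, t) : S × T))) (M.act S T m r) =
    (r.1 t : ℤ) • M.functor.map (res (orbitMap s)) m
  rw [orbitMap_pair, ← prodMap_res_comp_res_diag, map_comp_apply, M.act_prodMap,
    constantGreen_map_res_orbitMap, map_zsmul, map_zsmul, map_res_diag_act]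

/-- The morphism from a Mackey module to the fixed point functor of its value at `G/e`. -/
def toFixedPoints : M ⟶ (fixedPoints G).obj (underlying M) :=
  homMk (N := fixedPointModule (underlying M)) M.restrict (fun x m => M.restrict_map x m)
    (fun m r => M.restrict_act m r)

end MackeyModule

variable (G) in
/-- The natural transformation from a Mackey module to the fixed point functor of its value at
the free orbit. -/
def toFixedPointsHom : 𝟭 (ZMackeyModule G) ⟶ evalRegular G ⋙ fixedPoints G where
  app M := M.toFixedPoints
  naturality _ _ f := hom_ext fun _ m => Subtype.ext (funext fun s =>
    (naturality_apply f (res (orbitMap s)) m).symm)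

/-- A Mackey module `M` for which `M(S) → Map_G(S, M(G/e))` is bijective for all `S`: these are the
fixed point functors. -/
def IsFixedPoint (M : ZMackeyModule G) : Prop := ∀ S, Function.Bijective (M.restrict S)

theorem isIso_toFixedPointsHom_app (M : ZMackeyModule G) :
    IsIso ((toFixedPointsHom G).app M) ↔ IsFixedPoint M :=
  isIso_iff_bijective _

theorem isFixedPoint_fixedPoints (V : Rep.{u} ℤ G) : IsFixedPoint ((fixedPoints G).obj V) := by
  have key (S : Burnside G) (f : equivariantMaps (repAction V) S) (s : S) :
      ((((fixedPoints G).obj V).restrict S f).1 s : equivariantMaps (repAction V) (regular G)).1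
        (1 : G) = f.1 s :=
    (homMap_res_apply (repAction V) (orbitMap s) f (1 : G)).trans
      (congrArg f.1 (one_smul G s))
  have ext {v w : equivariantMaps (repAction V) (regular G)} (h : v.1 (1 : G) = w.1 (1 : G)) :
      v = w := Subtype.ext (funext fun g : G => by
    rw [← mul_one g]
    exact (v.2 g (1 : G)).trans ((congrArg _ h).trans (w.2 g (1 : G)).symm))
  refine fun S => ⟨fun f f' h => Subtype.ext (funext fun s => ?_), fun φ => ?_⟩
  · exact (key S f s).symm.trans ((congrArg (fun φ => (φ.1 s : equivariantMaps (repAction V)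
      (regular G)).1 (1 : G)) h).trans (key S f' s))
  · refine ⟨⟨fun s => (φ.1 s : equivariantMaps (repAction V) (regular G)).1 (1 : G),
      fun g s => ?_⟩, Subtype.ext (funext fun s => ext (key S _ s))⟩
    beta_reduce
    rw [φ.2]
    exact evalOneEquiv_map_mulRight V g _

/-- Fixed point functors are closed under kernels. -/
theorem IsFixedPoint.of_exact (S : ShortComplex (ZMackeyModule G)) (hS : S.Exact) (hf : Mono S.f)
    (h₂ : IsFixedPoint S.X₂) (h₃ : IsFixedPoint S.X₃) : IsFixedPoint S.X₁ := by
  have inj := injective_of_mono S.f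
  have nat {M N : ZMackeyModule G} (f : M ⟶ N) (T : Burnside G) (m : M.functor.obj T) (t : T) :
      (N.restrict T (f.app.app T m)).1 t = f.app.app (regular G) ((M.restrict T m).1 t) :=
    (naturality_apply f (res (orbitMap t)) m).symm
  refine fun T => ⟨fun m m' h => inj T ((h₂ T).1 (Subtype.ext (funext fun t => ?_))), fun φ => ?_⟩
  · rw [nat, nat, h]
  · obtain ⟨m, hm⟩ := (h₂ T).2 (postcomp ((evalRegular G).map S.f) T φ)
    have hm' (t : T) : (S.X₂.restrict T m).1 t = S.f.app.app (regular G) (φ.1 t) :=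
      congrFun (congrArg Subtype.val hm) t
    have h0 : S.g.app.app T m = 0 := (h₃ T).1 (Subtype.ext (funext fun t => by
      rw [nat, hm', map_zero]
      exact congrArg (fun k : S.X₁ ⟶ S.X₃ => k.app.app (regular G) (φ.1 t)) S.zero))
    have e : hS.lift (kerι S.g) (kerι_comp S.g) ≫ S.f = kerι S.g := hS.lift_f _ _
    refine ⟨(hS.lift (kerι S.g) (kerι_comp S.g)).app.app T ⟨m, h0⟩,
      Subtype.ext (funext fun t => inj _ ?_)⟩
    rw [← nat, ← hm']
    refine congrArg (fun m => (S.X₂.restrict T m).1 t) ?_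
    exact congrArg (fun k : ker S.g ⟶ S.X₂ => k.app.app T ⟨m, h0⟩) e

end
end MackeyChains

/-! ### Free modules over a Green functor -/

namespace MackeyChains

noncomputable section

namespace Burnside

variable {G : Type u} [Group G] {S T U V S' T' U' S'' T'' : Burnside G}

theorem of_comp_graph (A : Span S T) (f : T →[G] U) :
    (show S ⟶ T from Hom.of A) ≫ graph f = Hom.of ⟨A.apex, A.left, f.comp A.right⟩ := by
  refine (of_comp_of _ _).trans (Hom.of_eq_of_equiv
    { toFun := fun p => p.1.1
      invFun := fun a => ⟨(a, A.right a), rfl⟩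
      left_inv := by rintro ⟨⟨a, t⟩, h⟩; exact Subtype.ext (Prod.ext rfl h)
      right_inv := fun _ => rfl } (fun _ _ => rfl) (fun _ => rfl) ?_)
  rintro ⟨⟨a, t⟩, h⟩
  exact congrArg f h

theorem res_comp_of (f : S →[G] T) (A : Span S U) :
    res f ≫ (show S ⟶ U from Hom.of A) = Hom.of ⟨A.apex, f.comp A.left, A.right⟩ := by
  refine (of_comp_of _ _).trans (Hom.of_eq_of_equiv
    { toFun := fun p => p.1.2
      invFun := fun a => ⟨(A.left a, a), rfl⟩
      left_inv := by rintro ⟨⟨s, a⟩, h⟩; exact Subtype.ext (Prod.ext h.symm rfl)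
      right_inv := fun _ => rfl } (fun _ _ => rfl) ?_ (fun _ => rfl))
  rintro ⟨⟨s, a⟩, h⟩
  exact congrArg f h.symm

theorem graph_comp_graph (f : S →[G] T) (g : T →[G] U) : graph f ≫ graph g = graph (g.comp f) :=
  of_comp_graph _ _

theorem graph_eq_res (f : S →[G] T) (g : T →[G] S) (h : ∀ s, g (f s) = s) (h' : ∀ t, f (g t) = t) :
    graph f = res g :=
  Hom.of_eq_of_equiv ⟨f, g, h, h'⟩ (fun a s => map_smul f a s) h fun _ => rfl

theorem prodMap_id (S T : Burnside G) : prodMap (𝟙 S) (𝟙 T) = 𝟙 (S.prod T) :=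
  (prodFunctor G).map_id (S, T)

theorem prodMap_comp (x : S ⟶ S') (x' : S' ⟶ S'') (y : T ⟶ T') (y' : T' ⟶ T'') :
    prodMap (x ≫ x') (y ≫ y') = prodMap x y ≫ prodMap x' y' :=
  (prodFunctor G).map_comp (Prod.mkHom x y) (Prod.mkHom x' y')

theorem prodMap_add (x : S ⟶ S') (y y' : T ⟶ T') :
    prodMap x (y + y') = prodMap x y + prodMap x y' :=
  map_add (Hom.prod x : Hom T T' →+ Hom (S.prod T) (S'.prod T')) y y'

/-- The cartesian product of two maps. -/
def prodHom (f : S →[G] S') (g : T →[G] T') : S.prod T →[G] S'.prod T' :=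
  ⟨fun p => (f p.1, g p.2), fun a p => Prod.ext (map_smul f a p.1) (map_smul g a p.2)⟩

theorem prodMap_graph (f : S →[G] S') (g : T →[G] T') :
    prodMap (graph f) (graph g) = graph (prodHom f g) :=
  prodMap_of _ _

theorem prodMap_res (f : S →[G] S') (g : T →[G] T') :
    prodMap (res f) (res g) = res (prodHom f g) :=
  prodMap_of _ _

/-- The inverse of the associativity map. -/
def assocInv (S T U : Burnside G) : S.prod (T.prod U) →[G] (S.prod T).prod U :=
  ⟨fun p => ((p.1, p.2.1), p.2.2), fun _ _ => rfl⟩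

theorem graph_assoc (S T U : Burnside G) : graph (assoc S T U) = res (assocInv S T U) :=
  graph_eq_res _ _ (fun _ => rfl) (fun _ => rfl)

theorem graph_assoc_naturality (x : S ⟶ S') (y : T ⟶ T') (z : U ⟶ U') :
    prodMap (prodMap x y) z ≫ graph (assoc S' T' U') =
      graph (assoc S T U) ≫ prodMap x (prodMap y z) := by
  change Hom.comp (Hom.prod (Hom.prod x y) z) (graph (assoc S' T' U')) =
    Hom.comp (graph (assoc S T U)) (Hom.prod x (Hom.prod y z))
  induction x using Hom.ind with
  | hof A =>
    induction y using Hom.ind with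
    | hof B =>
      induction z using Hom.ind with
      | hof C =>
        simp only [Hom.prod_of]
        refine (of_comp_graph _ _).trans (Eq.trans ?_
          ((congrArg (· ≫ _) (graph_assoc S T U)).trans (res_comp_of _ _)).symm)
        exact Hom.of_eq_of_equiv (Equiv.prodAssoc _ _ _) (fun _ _ => rfl) (fun _ => rfl)
          (fun _ => rfl)
      | hsub x y hx hy => simp only [map_sub, AddMonoidHom.sub_apply, hx, hy]
    | hsub x y hx hy => simp only [map_sub, AddMonoidHom.sub_apply, hx, hy]
  | hsub x y hx hy => simp only [map_sub, AddMonoidHom.sub_apply, hx, hy]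

/-- The evaluation morphism of the self-dual object `S` of the Burnside category, multiplied by
`T`. -/
def eval (S T : Burnside G) : S.prod (S.prod T) ⟶ T :=
  Hom.of ⟨S.prod T, ⟨fun p => (p.1, p), fun _ _ => rfl⟩, ⟨fun p => p.2, fun _ _ => rfl⟩⟩

/-- The coevaluation morphism of the self-dual object `S` of the Burnside category. -/
def coeval (S : Burnside G) : point G ⟶ S.prod S := Hom.of ⟨S, toPoint S, diag S⟩

theorem prodMap_prodMap_comp_eval (S : Burnside G) (y : T ⟶ T') :
    prodMap (𝟙 S) (prodMap (𝟙 S) y) ≫ eval S T' = eval S T ≫ y := by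
  change Hom.comp (Hom.prod (Hom.of (Span.graph _)) (Hom.prod (Hom.of (Span.graph _)) y))
    (Hom.of _) = Hom.comp (Hom.of _) y
  induction y using Hom.ind with
  | hof A =>
    simp only [Hom.prod_of, Hom.comp_of]
    refine Hom.of_eq_of_equiv
      { toFun := fun p => ⟨((p.1.1.1, A.left p.1.1.2.2), p.1.1.2.2), rfl⟩
        invFun := fun q => ⟨((q.1.1.1, (q.1.1.1, q.1.2)), (q.1.1.1, A.right q.1.2)), rfl⟩
        left_inv := ?_
        right_inv := ?_ } ?_ ?_ ?_
    · rintro ⟨⟨⟨s, s', a⟩, s'', t⟩, h⟩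
      obtain ⟨rfl, rfl, rfl⟩ : s = s'' ∧ s' = s'' ∧ A.right a = t :=
        ⟨congrArg (fun q : S × S × T' => q.1) h, congrArg (fun q : S × S × T' => q.2.1) h,
          congrArg (fun q : S × S × T' => q.2.2) h⟩
      rfl
    · rintro ⟨⟨⟨s, t⟩, a⟩, h⟩
      obtain rfl : t = A.left a := h
      rfl
    · rintro g ⟨⟨⟨s, s', a⟩, s'', t⟩, h⟩
      exact Subtype.ext (Prod.ext (Prod.ext rfl (map_smul A.left g a)) rfl)
    · rintro ⟨⟨⟨s, s', a⟩, s'', t⟩, h⟩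
      obtain ⟨rfl, rfl, rfl⟩ : s = s'' ∧ s' = s'' ∧ A.right a = t :=
        ⟨congrArg (fun q : S × S × T' => q.1) h, congrArg (fun q : S × S × T' => q.2.1) h,
          congrArg (fun q : S × S × T' => q.2.2) h⟩
      rfl
    · rintro ⟨⟨⟨s, s', a⟩, s'', t⟩, h⟩
      obtain ⟨rfl, rfl, rfl⟩ : s = s'' ∧ s' = s'' ∧ A.right a = t :=
        ⟨congrArg (fun q : S × S × T' => q.1) h, congrArg (fun q : S × S × T' => q.2.1) h,
          congrArg (fun q : S × S × T' => q.2.2) h⟩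
      rfl
  | hsub x y hx hy => simp only [map_sub, AddMonoidHom.sub_apply, hx, hy]

theorem graph_assoc_comp_eval (S T U : Burnside G) :
    graph (assoc S (S.prod T) U) ≫ prodMap (𝟙 S) (graph (assoc S T U)) ≫ eval S (T.prod U) =
      prodMap (eval S T) (𝟙 U) := by
  rw [graph_assoc, graph_assoc, ← res_id, prodMap_res, eval, res_comp_of, res_comp_of]
  exact (Hom.of_eq_of_equiv (Equiv.prodAssoc _ _ _) (fun _ _ => rfl) (fun _ => rfl)
    (fun _ => rfl)).symm.trans (prodMap_of _ _).symm

theorem prodMap_coeval_comp_eval (S : Burnside G) :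
    prodMap (𝟙 S) (coeval S) ≫ eval S S = graph (rightUnit S) := by
  refine (congrArg (· ≫ eval S S) (prodMap_of _ _)).trans
    ((of_comp_of _ _).trans (Hom.of_eq_of_equiv
    { toFun := fun p => (p.1.1.1, PUnit.unit)
      invFun := fun x => ⟨((x.1, x.1), (x.1, x.1)), rfl⟩
      left_inv := ?_
      right_inv := fun _ => rfl } (fun _ _ => rfl) (fun _ => rfl) ?_))
  · rintro ⟨⟨⟨s, t⟩, a, b⟩, h⟩
    obtain ⟨rfl, rfl, rfl⟩ : s = a ∧ t = a ∧ t = b :=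
      ⟨congrArg (fun q : S × S × S => q.1) h, congrArg (fun q : S × S × S => q.2.1) h,
        congrArg (fun q : S × S × S => q.2.2) h⟩
    rfl
  · rintro ⟨⟨⟨s, t⟩, a, b⟩, h⟩
    obtain ⟨rfl, rfl, rfl⟩ : s = a ∧ t = a ∧ t = b :=
      ⟨congrArg (fun q : S × S × S => q.1) h, congrArg (fun q : S × S × S => q.2.1) h,
        congrArg (fun q : S × S × S => q.2.2) h⟩
    rfl

end Burnside

open Burnside

variable {G : Type u} [Group G]

namespace GreenFunctor

variable (R : GreenFunctor G)

theorem map_comp_apply {S T U : Burnside G} (x : S ⟶ T) (y : T ⟶ U) (m : R.functor.obj S) :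
    R.functor.map (x ≫ y) m = R.functor.map y (R.functor.map x m) := by
  simp

theorem map_id_apply {S : Burnside G} (m : R.functor.obj S) : R.functor.map (𝟙 S) m = m := by
  simp

theorem mul_prodMap {S S' T T' : Burnside G} (x : S ⟶ S') (y : T ⟶ T')
    (a : R.functor.obj S) (b : R.functor.obj T) :
    R.functor.map (prodMap x y) (R.mul S T a b) =
      R.mul S' T' (R.functor.map x a) (R.functor.map y b) :=
  R.mul_natural x y a b

/-- The free module over a Green functor `R` on a generator at `S`, which is `T ↦ R(S × T)`. -/
def freeModule (S : Burnside G) : MackeyModule R :=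
  MackeyModule.ofData (fun T => R.functor.obj (S.prod T))
    (fun x => (R.functor.map (prodMap (𝟙 S) x)).hom)
    (fun T U => (AddMonoidHom.compHom (R.functor.map (graph (assoc S T U))).hom).comp
      (R.mul (S.prod T) U))
    (fun T a => by
      change R.functor.map (prodMap (𝟙 S) (𝟙 T)) a = a
      rw [prodMap_id, map_id_apply])
    (fun x y a => by
      change R.functor.map (prodMap (𝟙 S) (x ≫ y)) a =
        R.functor.map (prodMap (𝟙 S) y) (R.functor.map (prodMap (𝟙 S) x) a)
      rw [← map_comp_apply, ← prodMap_comp, Category.id_comp])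
    (fun x y a => by
      change R.functor.map (prodMap (𝟙 S) (x + y)) a = _
      rw [prodMap_add, R.functor.map_add]
      rfl)
    (fun {T T' U U'} x y m r => by
      change R.functor.map (prodMap (𝟙 S) (prodMap x y)) (R.functor.map (graph (assoc S T U))
        (R.mul (S.prod T) U m r)) = R.functor.map (graph (assoc S T' U'))
        (R.mul (S.prod T') U' (R.functor.map (prodMap (𝟙 S) x) m) (R.functor.map y r))
      rw [← map_comp_apply, ← graph_assoc_naturality, map_comp_apply, mul_prodMap])
    (fun {T} m => by
      change R.functor.map (prodMap (𝟙 S) (graph (rightUnit T)))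
        (R.functor.map (graph (assoc S T (point G))) (R.mul (S.prod T) (point G) m R.one)) = m
      rw [← map_comp_apply, ← graph_id, prodMap_graph, graph_comp_graph]
      exact R.mul_one m)
    (fun {T U V} m r r' => by
      change R.functor.map (prodMap (𝟙 S) (graph (assoc T U V)))
        (R.functor.map (graph (assoc S (T.prod U) V)) (R.mul (S.prod (T.prod U)) V
          (R.functor.map (graph (assoc S T U)) (R.mul (S.prod T) U m r)) r')) =
        R.functor.map (graph (assoc S T (U.prod V))) (R.mul (S.prod T) (U.prod V) m
          (R.mul U V r r'))
      have h := R.mul_prodMap (graph (assoc S T U)) (𝟙 V) (R.mul (S.prod T) U m r) r'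
      rw [map_id_apply] at h
      rw [← R.mul_assoc, ← h, ← map_comp_apply, ← map_comp_apply, ← map_comp_apply, ← graph_id,
        ← graph_id, prodMap_graph, prodMap_graph, graph_comp_graph, graph_comp_graph,
        graph_comp_graph]
      rfl)

/-- The generator of the free module `T ↦ R(S × T)`: the transfer of the unit along the
diagonal. -/
def generator (S : Burnside G) : (R.freeModule S).functor.obj S :=
  R.functor.map (coeval S) R.one

end GreenFunctor

namespace MackeyModule

variable {R : GreenFunctor G} {M N : MackeyModule R} {S : Burnside G}

/-- The morphism from the free module on a generator at `S` given by an element of `M(S)`. -/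
def freeDesc (m : M.functor.obj S) : R.freeModule S ⟶ M :=
  homMk (M := R.freeModule S)
    (fun T => (M.functor.map (eval S T)).hom.comp (M.act S (S.prod T) m))
    (fun {T T'} y f => by
      change M.functor.map (eval S T') (M.act S (S.prod T') m
        (R.functor.map (prodMap (𝟙 S) y) f)) =
        M.functor.map y (M.functor.map (eval S T) (M.act S (S.prod T) m f))
      have h := M.act_prodMap (𝟙 S) (prodMap (𝟙 S) y) m f
      rw [map_id_apply] at h
      rw [← h, ← map_comp_apply, prodMap_prodMap_comp_eval, map_comp_apply])
    (fun {T U} (f : R.functor.obj (S.prod T)) r => by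
      change M.functor.map (eval S (T.prod U)) (M.act S (S.prod (T.prod U)) m
        (R.functor.map (graph (assoc S T U)) (R.mul (S.prod T) U f r))) =
        M.act T U (M.functor.map (eval S T) (M.act S (S.prod T) m f)) r
      have h := M.act_prodMap (𝟙 S) (graph (assoc S T U)) m (R.mul (S.prod T) U f r)
      have h' := M.act_prodMap (eval S T) (𝟙 U) (M.act S (S.prod T) m f) r
      rw [map_id_apply] at h
      rw [GreenFunctor.map_id_apply] at h'
      rw [← h, ← h', ← M.act_assoc, ← map_comp_apply, ← map_comp_apply,
        graph_assoc_comp_eval])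

theorem freeDesc_generator (m : M.functor.obj S) :
    (freeDesc m).app.app S (R.generator S) = m := by
  change M.functor.map (eval S S) (M.act S (S.prod S) m (R.functor.map (coeval S) R.one)) = m
  have h := M.act_prodMap (𝟙 S) (coeval S) m R.one
  rw [map_id_apply] at h
  rw [← h, ← map_comp_apply, prodMap_coeval_comp_eval, M.act_one]

theorem freeDesc_zero : freeDesc (0 : M.functor.obj S) = 0 :=
  hom_ext fun T (f : R.functor.obj (S.prod T)) => by
    change M.functor.map (eval S T) (M.act S (S.prod T) 0 f) = 0
    rw [map_zero, AddMonoidHom.zero_apply, map_zero]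

theorem freeDesc_comp (m : M.functor.obj S) (f : M ⟶ N) :
    freeDesc m ≫ f = freeDesc (f.app.app S m) :=
  hom_ext fun T x => (naturality_apply f (eval S T) (M.act S (S.prod T) m x)).trans
    (congrArg (N.functor.map (eval S T)) (f.app_act m x))

end MackeyModule

end
end MackeyChains

/-! ### Functorial covers by direct sums of free modules -/

namespace MackeyChains

noncomputable section
open Burnside DirectSum

variable {G : Type u} [Group G]

namespace MackeyModule

variable {R : GreenFunctor G}

section DirectSum

variable {ι : Type u} (M : ι → MackeyModule R) {N : MackeyModule R}

/-- The functoriality of a direct sum of modules, as a map of direct sums of abelian groups. -/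
def directSumMap {S T : Burnside G} (x : S ⟶ T) :
    (⨁ i, (M i).functor.obj S) →+ ⨁ i, (M i).functor.obj T :=
  DirectSum.map fun i => ((M i).functor.map x).hom

theorem directSumMap_apply {S T : Burnside G} (x : S ⟶ T) (m : ⨁ i, (M i).functor.obj S) (i : ι) :
    directSumMap M x m i = (M i).functor.map x (m i) :=
  DirectSum.map_apply _ i m

open Classical in
theorem directSumMap_of {S T : Burnside G} (x : S ⟶ T) (i : ι) (m : (M i).functor.obj S) :
    directSumMap M x (DirectSum.of _ i m) = DirectSum.of _ i ((M i).functor.map x m) :=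
  DirectSum.map_of _ _ _

open Classical in
/-- The action on a direct sum of modules, as a map of direct sums of abelian groups. -/
def directSumAct (S T : Burnside G) :
    (⨁ i, (M i).functor.obj S) →+ R.functor.obj T →+ ⨁ i, (M i).functor.obj (S.prod T) :=
  DirectSum.toAddMonoid fun i => (AddMonoidHom.compHom
    (DirectSum.of (fun i => (M i).functor.obj (S.prod T)) i)).comp ((M i).act S T)

open Classical in
theorem directSumAct_of {S T : Burnside G} (i : ι) (m : (M i).functor.obj S)
    (r : R.functor.obj T) : directSumAct M S T (DirectSum.of _ i m) r =
      DirectSum.of (fun i => (M i).functor.obj (S.prod T)) i ((M i).act S T m r) := by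
  rw [directSumAct, DirectSum.toAddMonoid_of]
  rfl

open Classical in
/-- The direct sum of a family of modules, computed objectwise. -/
def directSum : MackeyModule R :=
  ofData (fun S => ⨁ i, (M i).functor.obj S) (directSumMap M) (directSumAct M)
    (fun S a => DFinsupp.ext fun i => by
      rw [directSumMap_apply, map_id_apply])
    (fun x y a => DFinsupp.ext fun i => by
      simp only [directSumMap_apply, map_comp_apply])
    (fun x y a => DFinsupp.ext fun i => by
      rw [directSumMap_apply, map_add_apply, ← directSumMap_apply, ← directSumMap_apply]
      rfl)
    (fun {S S' T T'} x y m r => by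
      change directSumMap M (prodMap x y) (directSumAct M S T m r) = _
      induction m using DirectSum.induction_on with
      | zero => simp only [map_zero, AddMonoidHom.zero_apply]
      | of i m =>
        rw [directSumAct_of, directSumMap_of, directSumMap_of, directSumAct_of, act_prodMap]
      | add m m' h h' => simp only [map_add, AddMonoidHom.add_apply, h, h'])
    (fun m => by
      induction m using DirectSum.induction_on with
      | zero => simp only [map_zero, AddMonoidHom.zero_apply]
      | of i m => rw [directSumAct_of, directSumMap_of, (M i).act_one]
      | add m m' h h' => simp only [map_add, AddMonoidHom.add_apply, h, h'])
    (fun m r r' => by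
      induction m using DirectSum.induction_on with
      | zero => simp only [map_zero, AddMonoidHom.zero_apply]
      | of i m =>
        rw [directSumAct_of, directSumAct_of, directSumMap_of, directSumAct_of, (M i).act_assoc]
      | add m m' h h' => simp only [map_add, AddMonoidHom.add_apply, h, h'])

open Classical in
/-- The inclusion of a summand. -/
def directSumι (i : ι) : M i ⟶ directSum M :=
  homMk (N := directSum M) (fun S => DirectSum.of (fun i => (M i).functor.obj S) i)
    (fun x m => (directSumMap_of M x i m).symm) (fun m r => (directSumAct_of M i m r).symm)

variable {M}

open Classical in
theorem directSum_hom_ext {f g : directSum M ⟶ N}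
    (h : ∀ i, directSumι M i ≫ f = directSumι M i ≫ g) : f = g :=
  hom_ext fun S (m : ⨁ i, (M i).functor.obj S) => by
    have : ((f.app.app S).hom : (⨁ i, (M i).functor.obj S) →+ N.functor.obj S) =
        (g.app.app S).hom := DirectSum.addHom_ext fun i m =>
      congrArg (fun k : M i ⟶ N => k.app.app S m) (h i)
    exact DFunLike.congr_fun this m

open Classical in
/-- The morphism from a direct sum given by its components. -/
def directSumDesc (f : ∀ i, M i ⟶ N) : directSum M ⟶ N :=
  homMk (M := directSum M) (fun S => DirectSum.toAddMonoid fun i => ((f i).app.app S).hom)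
    (fun {S T} x (m : ⨁ i, (M i).functor.obj S) => by
      change DirectSum.toAddMonoid (fun i => ((f i).app.app T).hom) (directSumMap M x m) =
        N.functor.map x (DirectSum.toAddMonoid (fun i => ((f i).app.app S).hom) m)
      induction m using DirectSum.induction_on with
      | zero => simp only [map_zero]
      | of i m =>
        rw [directSumMap_of, DirectSum.toAddMonoid_of, DirectSum.toAddMonoid_of]
        exact naturality_apply (f i) x m
      | add m m' h h' => simp only [map_add, h, h'])
    (fun {S T} (m : ⨁ i, (M i).functor.obj S) r => by
      change DirectSum.toAddMonoid (fun i => ((f i).app.app (S.prod T)).hom)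
        (directSumAct M S T m r) =
        N.act S T (DirectSum.toAddMonoid (fun i => ((f i).app.app S).hom) m) r
      induction m using DirectSum.induction_on with
      | zero => simp only [map_zero, AddMonoidHom.zero_apply]
      | of i m =>
        rw [directSumAct_of, DirectSum.toAddMonoid_of, DirectSum.toAddMonoid_of]
        exact (f i).app_act m r
      | add m m' h h' => simp only [map_add, AddMonoidHom.add_apply, h, h'])

theorem directSumι_desc (f : ∀ i, M i ⟶ N) (i : ι) : directSumι M i ≫ directSumDesc f = f i :=
  hom_ext fun S m => by
    classical
    exact DirectSum.toAddMonoid_of (fun i => ((f i).app.app S).hom) i m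

end DirectSum

/-- A finite `G`-set whose underlying set is `{0, …, n - 1}`. These `G`-sets form a small set which
contains a representative of every isomorphism class of finite `G`-sets. -/
abbrev StandardGSet (G : Type u) [Group G] : Type u := Σ n : ℕ, MulAction G (ULift.{u} (Fin n))

/-- A `G`-set with underlying set `{0, …, n - 1}`, as an object of the Burnside category. -/
def standard (s : StandardGSet G) : Burnside G :=
  let _ := s.2
  ⟨ULift.{u} (Fin s.1)⟩

theorem exists_standard (S : Burnside G) : ∃ (s : StandardGSet G) (f : S →[G] standard s)
    (g : standard s →[G] S), ∀ x, g (f x) = x := by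
  obtain ⟨n, ⟨e⟩⟩ := Finite.exists_equiv_fin S
  let e' : ULift.{u} (Fin n) ≃ S := Equiv.ulift.trans e.symm
  exact ⟨⟨n, e'.mulAction G⟩, ⟨e'.symm, fun g x => by
      change e'.symm (g • x) = e'.symm (g • e' (e'.symm x))
      rw [e'.apply_symm_apply]⟩,
    ⟨e', fun g x => e'.apply_symm_apply (g • e' x)⟩, e'.apply_symm_apply⟩

/-- The indices of the summands of the free cover of a module: its nonzero elements. -/
abbrev CoverIndex (M : MackeyModule R) : Type u :=
  Σ s : StandardGSet G, {m : M.functor.obj (standard s) // m ≠ 0}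

/-- The direct sum of free modules with one generator for each nonzero element of `M`. Zero is
excluded in order that `M ↦ cover M` preserves zero morphisms. -/
def cover (M : MackeyModule R) : MackeyModule R :=
  directSum fun i : CoverIndex M => R.freeModule (standard i.1)

variable {M N P : MackeyModule R}

open Classical in
/-- The morphism from a free module to the free cover which is given by an element of `M`; it is
the inclusion of a summand if the element is not zero, and zero otherwise. -/
def coverι {s : StandardGSet G} (m : M.functor.obj (standard s)) :
    R.freeModule (standard s) ⟶ cover M :=
  if h : m ≠ 0 then directSumι (fun i : CoverIndex M => R.freeModule (standard i.1)) ⟨s, m, h⟩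
  else 0

theorem coverι_of_ne_zero {s : StandardGSet G} {m : M.functor.obj (standard s)} (h : m ≠ 0) :
    coverι m = directSumι (fun i : CoverIndex M => R.freeModule (standard i.1)) ⟨s, m, h⟩ :=
  dif_pos h

theorem coverι_zero {s : StandardGSet G} : coverι (0 : M.functor.obj (standard s)) = 0 :=
  dif_neg (not_not.2 rfl)

theorem cover_hom_ext {f g : cover M ⟶ N}
    (h : ∀ (s : StandardGSet G) (m : M.functor.obj (standard s)), coverι m ≫ f = coverι m ≫ g) :
    f = g :=
  directSum_hom_ext fun i =>
    (congrArg (· ≫ f) (coverι_of_ne_zero i.2.2)).symm.trans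
      ((h i.1 i.2.1).trans (congrArg (· ≫ g) (coverι_of_ne_zero i.2.2)))

/-- The morphism from the free cover given by a family of morphisms from free modules. -/
def coverDesc (f : ∀ (s : StandardGSet G) (_ : M.functor.obj (standard s)),
    R.freeModule (standard s) ⟶ N) : cover M ⟶ N :=
  directSumDesc fun i => f i.1 i.2.1

theorem coverι_desc (f : ∀ (s : StandardGSet G) (_ : M.functor.obj (standard s)),
    R.freeModule (standard s) ⟶ N) (hf : ∀ s, f s 0 = 0) {s : StandardGSet G}
    (m : M.functor.obj (standard s)) : coverι m ≫ coverDesc f = f s m := by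
  by_cases h : m = 0
  · rw [h, coverι_zero, hf, Limits.zero_comp]
  · exact (congrArg (· ≫ coverDesc f) (coverι_of_ne_zero h)).trans (directSumι_desc _ _)

/-- The functoriality of the free cover. -/
def coverMap (f : M ⟶ N) : cover M ⟶ cover N :=
  coverDesc fun s m => coverι (f.app.app (standard s) m)

theorem coverι_map (f : M ⟶ N) {s : StandardGSet G} (m : M.functor.obj (standard s)) :
    coverι m ≫ coverMap f = coverι (f.app.app (standard s) m) :=
  coverι_desc _ (fun s => by rw [map_zero, coverι_zero]) m

/-- The projection of the free cover of `M` to `M`. -/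
def coverProj (M : MackeyModule R) : cover M ⟶ M := coverDesc fun _ m => freeDesc m

theorem coverι_proj {s : StandardGSet G} (m : M.functor.obj (standard s)) :
    coverι m ≫ coverProj M = freeDesc m :=
  coverι_desc _ (fun _ => freeDesc_zero) m

variable (R) in
/-- The free cover, as a functor. -/
def coverFunctor : MackeyModule R ⥤ MackeyModule R where
  obj := cover
  map := coverMap
  map_id M := cover_hom_ext fun s m => (coverι_map _ m).trans (Category.comp_id _).symm
  map_comp f g := cover_hom_ext fun s m => by
    rw [coverι_map, ← Category.assoc, coverι_map, coverι_map, comp_app_apply]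

instance : (coverFunctor R).PreservesZeroMorphisms where
  map_zero _ _ := cover_hom_ext fun _ m =>
    (coverι_map _ m).trans (coverι_zero.trans Limits.comp_zero.symm)

variable (R) in
/-- The projection of the free cover, as a natural transformation. -/
def coverπ : coverFunctor R ⟶ 𝟭 (MackeyModule R) where
  app := coverProj
  naturality M N f := cover_hom_ext fun s m => by
    change coverι m ≫ coverMap f ≫ coverProj N = coverι m ≫ coverProj M ≫ f
    rw [← Category.assoc, coverι_map, coverι_proj, ← Category.assoc, coverι_proj, freeDesc_comp]

instance (M : MackeyModule R) : Epi ((coverπ R).app M) :=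
  epi_of_surjective _ fun S m => by
    obtain ⟨s, f, g, h⟩ := exists_standard S
    let m' := M.functor.map (res g) m
    refine ⟨(cover M).functor.map (res f)
      ((coverι m').app.app (standard s) (R.generator (standard s))), ?_⟩
    refine (naturality_apply ((coverπ R).app M) (res f) _).trans ?_
    have e : coverι m' ≫ (coverπ R).app M = freeDesc m' := coverι_proj m'
    have : ((coverπ R).app M).app.app (standard s)
        ((coverι m').app.app (standard s) (R.generator (standard s))) = m' :=
      (congrArg (fun k : R.freeModule (standard s) ⟶ M => k.app.app (standard s)
        (R.generator (standard s))) e).trans (freeDesc_generator m')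
    rw [this]
    change M.functor.map (res f) (M.functor.map (res g) m) = m
    rw [← map_comp_apply, res_comp_res, show g.comp f = MulActionHom.id G from
      MulActionHom.ext h, res_id, map_id_apply]

end MackeyModule

open MackeyModule

variable [Finite G]

theorem isFixedPoint_freeModule (S : Burnside G) :
    IsFixedPoint ((constantGreen G).freeModule S) := by
  have key (T : Burnside G) (f : equivariantMaps (trivialAction G) (S.prod T)) (t : T) (s : S)
      (x : G) : ((((constantGreen G).freeModule S).restrict T f).1 t :
        equivariantMaps (trivialAction G) (S.prod (regular G))).1 (s, x) = f.1 (s, x • t) := by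
    refine Eq.trans ?_ (homMap_res_apply (trivialAction G)
      (prodHom (MulActionHom.id G) (orbitMap t)) f (s, x))
    rw [← prodMap_res]
    rfl
  refine fun T => ⟨fun f f' h => ?_, fun φ => ?_⟩
  · change equivariantMaps (trivialAction G) (S.prod T) at f f'
    refine Subtype.ext (funext fun ⟨s, t⟩ => ?_)
    have := congrArg (fun φ => (φ.1 t : equivariantMaps (trivialAction G)
      (S.prod (regular G))).1 (s, (1 : G))) h
    refine Eq.trans ?_ (((key T f t s 1).symm.trans (this.trans (key T f' t s 1))).trans ?_)
    · rw [one_smul]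
    · rw [one_smul]
  · let ψ (t : T) : equivariantMaps (trivialAction G) (S.prod (regular G)) := φ.1 t
    have hψ (g : G) (t : T) (s : S) (x : G) : (ψ (g • t)).1 (s, x) = (ψ t).1 (s, x * g) := by
      refine (congrArg (fun f : equivariantMaps (trivialAction G) (S.prod (regular G)) =>
        f.1 (s, x)) (φ.2 g t)).trans ?_
      refine Eq.trans ?_ (homMap_res_apply (trivialAction G)
        (prodHom (MulActionHom.id G) (mulRight g)) (ψ t) (s, x))
      rw [← prodMap_res]
      rfl
    have hψ' (g : G) (t : T) (s : S) (x : G) : (ψ t).1 (g • s, g * x) = (ψ t).1 (s, x) :=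
      (ψ t).2 g (s, x)
    let f : equivariantMaps (trivialAction G) (S.prod T) :=
      ⟨fun p => (ψ p.2).1 (p.1, (1 : G)), fun g p => by
        refine (hψ g p.2 (g • p.1) 1).trans (Eq.trans ?_ (hψ' g p.2 p.1 1))
        rw [one_mul, mul_one]⟩
    refine ⟨f, Subtype.ext (funext fun t => ?_)⟩
    refine Subtype.ext (funext fun ⟨s, x⟩ => (key T f t s x).trans ?_)
    exact (hψ x t s 1).trans (congrArg (fun y : G => (ψ t).1 (s, y)) (one_mul (show G from x)))

theorem isFixedPoint_directSum {ι : Type u} (M : ι → ZMackeyModule G)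
    (hM : ∀ i, IsFixedPoint (M i)) : IsFixedPoint (directSum M) := by
  classical
  have key (T : Burnside G) (m : ⨁ i, (M i).functor.obj T) (t : T) (i : ι) :
      (show ⨁ i, (M i).functor.obj (regular G) from ((directSum M).restrict T m).1 t) i =
        ((M i).restrict T (m i)).1 t :=
    directSumMap_apply M (res (orbitMap t)) m i
  refine fun T => ⟨fun m m' h => ?_, fun φ => ?_⟩
  · change ⨁ i, (M i).functor.obj T at m m'
    refine DFinsupp.ext fun i => (hM i T).1 (Subtype.ext (funext fun t => ?_))
    refine (key T m t i).symm.trans (Eq.trans ?_ (key T m' t i))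
    exact congrArg (fun φ : equivariantMaps (repAction (directSum M).underlying) T =>
      (show ⨁ i, (M i).functor.obj (regular G) from φ.1 t) i) h
  · let ψ (t : T) : ⨁ i, (M i).functor.obj (regular G) := φ.1 t
    have hψ (g : G) (t : T) : ψ (g • t) = directSumMap M (res (mulRight g)) (ψ t) := φ.2 g t
    let φ' (i : ι) : equivariantMaps (repAction (underlying (M i))) T :=
      ⟨fun t => ψ t i, fun g t => by
        beta_reduce
        rw [hψ, directSumMap_apply]
        rfl⟩
    choose m hm using fun i => (hM i T).2 (φ' i)
    have := Fintype.ofFinite T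
    -- Only finitely many components of `φ` are nonzero since `T` is finite.
    let s : Finset ι := Finset.univ.biUnion fun t => DFinsupp.support (ψ t)
    refine ⟨DirectSum.mk (fun i => (M i).functor.obj T) s fun i => m i,
      Subtype.ext (funext fun t => DFinsupp.ext fun i => (key T _ t i).trans ?_)⟩
    by_cases hi : i ∈ s
    · rw [DirectSum.mk_apply_of_mem hi]
      exact congrFun (congrArg Subtype.val (hm i)) t
    · rw [DirectSum.mk_apply_of_notMem hi, map_zero]
      have : i ∉ DFinsupp.support (ψ t) := fun h =>
        hi (Finset.mem_biUnion.2 ⟨t, Finset.mem_univ t, h⟩)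
      exact (DFinsupp.notMem_support_iff.1 this).symm

theorem isFixedPoint_cover (M : ZMackeyModule G) : IsFixedPoint (cover M) :=
  isFixedPoint_directSum _ fun _ => isFixedPoint_freeModule _

end
end MackeyChains

/-! ### Quasi-isomorphisms are detected on orbits -/

namespace MackeyChains

noncomputable section

namespace Burnside

variable {G : Type u} [Group G]

/-- The transitive `G`-set `G/H`. -/
def coset [Finite G] (H : Subgroup G) : Burnside G := ⟨G ⧸ H⟩

variable [Finite G]

/-- The equivariant map `G/Stab(s) → S` onto the orbit of an element. -/
def stabilizerMap {S : Burnside G} (s : S) : coset (MulAction.stabilizer G s) →[G] S :=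
  ⟨MulAction.ofQuotientStabilizer G s, fun g x => MulAction.ofQuotientStabilizer_smul G s g x⟩

/-- The identity of a finite `G`-set is the sum, over its orbits, of the restriction to the orbit
followed by the transfer from the orbit. -/
theorem id_eq_finsum_orbits (S : Burnside G) :
    𝟙 S = ∑ᶠ ω : MulAction.orbitRel.Quotient G S,
      res (stabilizerMap ω.out) ≫ graph (stabilizerMap ω.out) := by
  have h (ω : MulAction.orbitRel.Quotient G S) :
      res (stabilizerMap ω.out) ≫ graph (stabilizerMap ω.out) =
        Hom.of ⟨coset _, stabilizerMap ω.out, stabilizerMap ω.out⟩ := of_comp_graph _ _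
  rw [finsum_congr h]
  refine Eq.trans (Eq.symm (Hom.of_eq_of_equiv
    (A := Span.sigma fun ω : MulAction.orbitRel.Quotient G S =>
      ⟨coset _, stabilizerMap ω.out, stabilizerMap ω.out⟩) (B := Span.graph (MulActionHom.id G))
    (Equiv.ofBijective (fun x => stabilizerMap x.1.out x.2) ⟨?_, fun s => ?_⟩)
    (fun g x => map_smul (stabilizerMap x.1.out) g x.2) (fun _ => rfl) fun _ => rfl))
    (Hom.of_sigma _)
  · have key (ω : MulAction.orbitRel.Quotient G S)
        (q : G ⧸ MulAction.stabilizer G ω.out) :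
        (Quotient.mk'' (MulAction.ofQuotientStabilizer G ω.out q) :
          MulAction.orbitRel.Quotient G S) = ω := by
      refine Eq.trans ?_ (Quotient.out_eq' ω)
      exact Quotient.sound (MulAction.ofQuotientStabilizer_mem_orbit G ω.out q)
    rintro ⟨ω, q⟩ ⟨ω', q'⟩ h
    change MulAction.ofQuotientStabilizer G ω.out q =
      MulAction.ofQuotientStabilizer G ω'.out q' at h
    obtain rfl : ω = ω' := (key ω q).symm.trans ((congrArg _ h).trans (key ω' q'))
    exact congrArg (Sigma.mk ω) (MulAction.injective_ofQuotientStabilizer G ω.out h)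
  · let ω : MulAction.orbitRel.Quotient G S := Quotient.mk'' s
    obtain ⟨g, hg⟩ : s ∈ MulAction.orbit G ω.out :=
      Quotient.exact (Quotient.out_eq' ω).symm
    exact ⟨⟨ω, (g : G ⧸ MulAction.stabilizer G ω.out)⟩, hg⟩

end Burnside

namespace MackeyModule
open Burnside

variable {G : Type u} [Group G] {R : GreenFunctor G}

/-- Evaluation of Mackey modules at a finite `G`-set. -/
def evaluation (R : GreenFunctor G) (S : Burnside G) : MackeyModule R ⥤ AddCommGrpCat.{u} where
  obj M := M.functor.obj S
  map f := f.app.app S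

instance (S : Burnside G) : (evaluation R S).Additive where

instance (S : Burnside G) : (evaluation R S).PreservesHomology := by
  refine ((Functor.exact_tfae (evaluation R S)).out 0 2).1 fun K hK => ?_
  have := hK.mono_f
  have := hK.epi_g
  refine { exact := ?_, mono_f := ?_, epi_g := ?_ }
  · refine (ShortComplex.ab_exact_iff _).2 fun m hm => ?_
    refine ⟨(hK.exact.lift (kerι K.g) (kerι_comp K.g)).app.app S ⟨m, hm⟩, ?_⟩
    exact congrArg (fun k : ker K.g ⟶ K.X₂ => k.app.app S ⟨m, hm⟩)
      (hK.exact.lift_f (kerι K.g) (kerι_comp K.g))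
  · exact (AddCommGrpCat.mono_iff_injective _).2 (injective_of_mono K.f S)
  · exact (AddCommGrpCat.epi_iff_surjective _).2 (surjective_of_epi K.g S)

variable [Finite G] {M N : MackeyModule R}

theorem eq_finsum_orbits (M : MackeyModule R) {S : Burnside G} (m : M.functor.obj S) :
    m = ∑ᶠ ω : MulAction.orbitRel.Quotient G S,
      M.functor.map (graph (stabilizerMap ω.out))
        (M.functor.map (res (stabilizerMap ω.out)) m) := by
  have h := map_finsum_apply (M := M) (fun ω : MulAction.orbitRel.Quotient G S =>
      res (stabilizerMap ω.out) ≫ graph (stabilizerMap ω.out)) m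
  rw [← id_eq_finsum_orbits, map_id_apply] at h
  exact h.trans (finsum_congr fun ω => map_comp_apply _ _ _)

/-- Morphisms of Mackey modules which are bijective on all orbits `G/H` are isomorphisms. -/
theorem isIso_of_bijective_coset (f : M ⟶ N)
    (hf : ∀ H : Subgroup G, Function.Bijective (f.app.app (coset H))) : IsIso f := by
  refine (isIso_iff_bijective f).2 fun S =>
    ⟨(injective_iff_map_eq_zero (f.app.app S).hom).2 fun m hm => ?_, fun n => ?_⟩
  · rw [M.eq_finsum_orbits m]
    refine finsum_eq_zero_of_forall_eq_zero fun ω => ?_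
    have h : M.functor.map (res (stabilizerMap ω.out)) m = 0 :=
      (injective_iff_map_eq_zero (f.app.app _).hom).1 (hf _).1 _
        ((naturality_apply f (res (stabilizerMap ω.out)) m).trans
          ((congrArg (N.functor.map (res (stabilizerMap ω.out))) hm).trans
            (map_zero (N.functor.map (res (stabilizerMap ω.out))).hom)))
    rw [h, map_zero]
  · choose m hm using fun ω : MulAction.orbitRel.Quotient G S =>
      (hf (MulAction.stabilizer G ω.out)).2 (N.functor.map (res (stabilizerMap ω.out)) n)
    let x (ω : MulAction.orbitRel.Quotient G S) : M.functor.obj S :=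
      M.functor.map (graph (stabilizerMap ω.out)) (m ω)
    refine ⟨∑ᶠ ω, x ω, (map_finsum (f.app.app S).hom (f := x) (Set.toFinite _)).trans ?_⟩
    refine Eq.trans (finsum_congr fun ω => ?_) (N.eq_finsum_orbits n).symm
    exact (naturality_apply f _ _).trans (congrArg _ (hm ω))

/-- A morphism of complexes of Mackey modules is a quasi-isomorphism if and only if it is so on all
orbits `G/H`. -/
theorem quasiIso_iff_evaluation_coset {ι : Type*} {c : ComplexShape ι}
    {K L : HomologicalComplex (MackeyModule R) c} (f : K ⟶ L) :
    QuasiIso f ↔ ∀ H : Subgroup G,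
      QuasiIso (((evaluation R (coset H)).mapHomologicalComplex c).map f) := by
  refine ⟨fun _ _ => inferInstance, fun h => ⟨fun i => ?_⟩⟩
  rw [quasiIsoAt_iff, ShortComplex.quasiIso_iff]
  refine isIso_of_bijective_coset _ fun H => ?_
  refine (ConcreteCategory.isIso_iff_bijective ((evaluation R (coset H)).map _)).1 ?_
  refine ((MorphismProperty.isomorphisms _).arrow_mk_iso_iff
    (((Functor.mapArrowFunctor _ _).mapIso
      (ShortComplex.homologyFunctorIso (evaluation R (coset H)))).app (Arrow.mk _))).1 ?_
  exact (ShortComplex.quasiIso_iff _).1 ((quasiIsoAt_iff _ i).1 ((h H).quasiIsoAt i))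

end MackeyModule

open Burnside MackeyModule
variable {G : Type u} [Group G] [Finite G]

/-- Evaluation at the coset of the neutral element identifies `Map_G(G/H, V)` with `V^H`. -/
def evalCosetEquiv (V : Rep.{u} ℤ G) (H : Subgroup G) :
    equivariantMaps (repAction V) (coset H) ≃+ (subgroupFixedPoints H).obj V where
  toFun f := ⟨f.1 ((1 : G) : G ⧸ H), fun h => by
    refine (f.2 h ((1 : G) : G ⧸ H)).symm.trans (congrArg f.1 ?_)
    exact (QuotientGroup.eq (s := H)).2 (by simp)⟩
  map_add' _ _ := rfl
  invFun v := ⟨fun x : G ⧸ H => Quotient.liftOn' x (fun g => V.ρ g v.1) fun a b hab => by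
      have h := v.2 ⟨a⁻¹ * b, QuotientGroup.leftRel_apply.1 hab⟩
      change V.ρ (a⁻¹ * b) v.1 = v.1 at h
      refine Eq.trans (congrArg (V.ρ a) h.symm) (Eq.trans (Eq.symm ?_)
        (congrArg (fun c => V.ρ c v.1) (mul_inv_cancel_left a b)))
      rw [map_mul]
      rfl,
    fun g (x : G ⧸ H) => by
      induction x using QuotientGroup.induction_on with | _ a
      change V.ρ (g * a) v.1 = V.ρ g (V.ρ a v.1)
      rw [map_mul]
      rfl⟩
  left_inv f := Subtype.ext (funext fun x : G ⧸ H => by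
    induction x using QuotientGroup.induction_on with | _ a
    refine (f.2 a ((1 : G) : G ⧸ H)).symm.trans (congrArg f.1 ?_)
    exact congrArg (QuotientGroup.mk (s := H)) (mul_one a))
  right_inv v := Subtype.ext (by
    change V.ρ 1 v.1 = v.1
    rw [map_one]
    rfl)

/-- The value of the fixed point Mackey functor at `G/H` is given by the `H`-fixed points. -/
def fixedPointsCompEvaluation (H : Subgroup G) :
    fixedPoints G ⋙ evaluation (constantGreen G) (coset H) ≅
      subgroupFixedPoints H ⋙ forget₂ (ModuleCat.{u} ℤ) AddCommGrpCat.{u} :=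
  NatIso.ofComponents (fun V => (evalCosetEquiv V H).toAddCommGrpIso) fun _ => rfl

/-- The fp-equivalences are the chain maps which become quasi-isomorphisms of complexes of Mackey
modules, since the latter are detected by the values `V^H` at the orbits `G/H`. -/
theorem fpEquivalences_iff {C D : ChainComplex (Rep.{u} ℤ G) ℤ} (f : C ⟶ D) :
    fpEquivalences G f ↔
      QuasiIso (((fixedPoints G).mapHomologicalComplex (ComplexShape.down ℤ)).map f) := by
  rw [quasiIso_iff_evaluation_coset]
  refine forall_congr' fun H => ?_
  rw [← HomologicalComplex.quasiIso_map_iff_of_preservesHomology _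
    (forget₂ (ModuleCat.{u} ℤ) AddCommGrpCat.{u})]
  exact (quasiIso_iff_of_arrow_mk_iso _ _ (((Functor.mapArrowFunctor _ _).mapIso
    (NatIso.mapHomologicalComplex (fixedPointsCompEvaluation H) (ComplexShape.down ℤ))).app
      (Arrow.mk f))).symm

end
end MackeyChains

/-! ### The derived category of fp-equivalences -/

namespace MackeyChains

noncomputable section

open MackeyModule

section
variable {C : Type*} [Category* C] [Abelian C]

/-- Reindexing along `n ↦ -n` preserves and reflects quasi-isomorphisms. -/
theorem quasiIso_cochainComplexEquivalence_functor_map_iff {K L : ChainComplex C ℤ} (f : K ⟶ L) :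
    QuasiIso ((ChainComplex.cochainComplexEquivalence C).functor.map f) ↔ QuasiIso f := by
  have key (n : ℤ) : QuasiIsoAt ((ChainComplex.cochainComplexEquivalence C).functor.map f) n ↔
      QuasiIsoAt f (-n) := by
    rw [quasiIsoAt_iff' _ (n - 1) n (n + 1) (by simp) (by simp),
      quasiIsoAt_iff' f (-(n - 1)) (-n) (-(n + 1)) (by simp; ring) (by simp; ring)]
    exact Iff.rfl
  rw [quasiIso_iff, quasiIso_iff]
  refine ⟨fun h n => ?_, fun h n => (key n).2 (h _)⟩
  rw [← neg_neg n]
  exact (key _).1 (h _)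

end

variable {G : Type u} [Group G] [Finite G]

/-- The derived category of fp-equivalences, as a localization of cochain complexes. -/
instance isLocalization_fpEquivalences :
    ((ChainComplex.cochainComplexEquivalence (Rep.{u} ℤ G)).inverse ⋙
      (fpEquivalences G).Q).IsLocalization
        ((HomologicalComplex.quasiIso (ZMackeyModule G) (ComplexShape.up ℤ)).inverseImage
          ((fixedPoints G).mapHomologicalComplex (ComplexShape.up ℤ))) := by
  let E := ChainComplex.cochainComplexEquivalence (Rep.{u} ℤ G)
  let W := (HomologicalComplex.quasiIso (ZMackeyModule G) (ComplexShape.up ℤ)).inverseImage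
    ((fixedPoints G).mapHomologicalComplex (ComplexShape.up ℤ))
  have key {C D : ChainComplex (Rep.{u} ℤ G) ℤ} (f : C ⟶ D) :
      W (E.functor.map f) ↔ fpEquivalences G f :=
    (quasiIso_cochainComplexEquivalence_functor_map_iff
      (((fixedPoints G).mapHomologicalComplex (ComplexShape.down ℤ)).map f)).trans
        (fpEquivalences_iff f).symm
  refine Functor.IsLocalization.of_equivalence_source (fpEquivalences G).Q (fpEquivalences G) _ W E
    (fun C D f hf => W.le_isoClosure _ ((key f).2 hf)) (fun C D f hf => ?_)
    ((Functor.associator _ _ _).symm ≪≫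
      Functor.isoWhiskerRight E.unitIso.symm _ ≪≫ Functor.leftUnitor _)
  refine Localization.inverts (fpEquivalences G).Q (fpEquivalences G) _ ((key _).1 ?_)
  have e : Arrow.mk (E.functor.map (E.inverse.map f)) ≅ Arrow.mk f :=
    ((Functor.mapArrowFunctor _ _).mapIso E.counitIso).app (Arrow.mk f)
  exact (W.arrow_mk_iso_iff e).2 hf

end
end MackeyChains

open MackeyChains
theorem mainTheorem1 (G : Type u) [Group G] [Finite G]
    [HasDerivedCategory.{w} (ZMackeyModule G)] :
    ∃ e : DerivedFP G ≌ DerivedCategory (ZMackeyModule G),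
      Nonempty ((fpEquivalences G).Q ⋙ e.functor ≅ fixedPointsDerived G) := by
  let E := ChainComplex.cochainComplexEquivalence (Rep.{u} ℤ G)
  obtain ⟨e, ⟨i⟩⟩ := exists_equivalence_derivedCategory (fixedPoints G) (evalRegular G)
    (toFixedPointsHom G) (fixedPointsCompEvalRegular G)
    (fun V => (isIso_toFixedPointsHom_app _).2 (isFixedPoint_fixedPoints V))
    (fun S hS hf h₂ h₃ => (isIso_toFixedPointsHom_app _).2 (IsFixedPoint.of_exact S hS hf
      ((isIso_toFixedPointsHom_app _).1 h₂) ((isIso_toFixedPointsHom_app _).1 h₃)))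
    (MackeyModule.coverFunctor (constantGreen G)) (MackeyModule.coverπ (constantGreen G))
    (fun M => (isIso_toFixedPointsHom_app _).2 (isFixedPoint_cover M))
    (E.inverse ⋙ (fpEquivalences G).Q)
  exact ⟨e, ⟨Functor.isoWhiskerRight ((Functor.leftUnitor _).symm ≪≫
      Functor.isoWhiskerRight E.unitIso (fpEquivalences G).Q) e.functor ≪≫
    Functor.isoWhiskerLeft E.functor i⟩⟩
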